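/- Let $S_\infty$ be the group of permutations $w$ of $\{1,2,3,\dots\}$ that fix all but finitely many points, written in one-line notation $w=w_1w_2w_3\cdots$, let $\ell(w)$ be the number of inversions of $w$, and let $(a,b)$ be the transposition of $a$ and $b$, so that $w\,(a,b)$ is obtained from $w$ by exchanging the entries in positions $a$ and $b$. For $w\in S_\infty$ the Schubert polynomial is $$\mathfrak S_w=\sum_{\rho}\ \sum_{\alpha}\ x_{\alpha_1}\cdots x_{\alpha_{\ell(w)}},$$ where $\rho=(\rho_1,\dots,\rho_{\ell(w)})$ runs over the words with $w=s_{\rho_1}\cdots s_{\rho_{\ell(w)}}$, $s_i=(i,i+1)$, and $\alpha$ over the weakly increasing sequences of positive integers with $\alpha_j\le\rho_j$ for all $j$ and $\alpha_j<\alpha_{j+1}$ whenever $\rho_j<\rho_{j+1}$. For a partition $\lambda$ with at most $k$ parts, $v(\lambda,k)\in S_\infty$ is the permutation with $v(\lambda,k)_i=i+\lambda_{k-i+1}$ for $1\le i\le k$ and $v(\lambda,k)_{i}<v(\lambda,k)_{i+1}$ for $i>k$. Let $k$ be a positive integer, let $u\in S_\infty$ satisfy $u_i<u_{i+1}$ for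 all $i>k$, let $\lambda$ be a partition with at most $k$ parts, and let $n=|\lambda|$. Then there is exactly one finitely supported family of integers $(c^w_{u,v(\lambda,k)})_{w\in S_\infty}$ with $$\mathfrak S_u\,\mathfrak S_{v(\lambda,k)}=\sum_{w\in S_\infty}c^w_{u,v(\lambda,k)}\,\mathfrak S_w ,$$ and for every $w\in S_\infty$ the coefficient $c^w_{u,v(\lambda,k)}$ is the number of elements of a subset of the set of chains $$w=u\,(a_1,b_1)\cdots(a_n,b_n),\qquad a_i\le k<b_i\quad(1\le i\le n),$$ in which $\ell\bigl(u\,(a_1,b_1)\cdots(a_i,b_i)\bigr)=\ell(u)+i$ for $0\le i\le n$ (in particular $\ell(w)=\ell(u)+n$). In particular $c^w_{u,v(\lambda,k)}$ is a nonnegative integer. -/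

import Mathlib

/-! Conventions. The positive integers `1, 2, 3, …` that index positions, values and variables are
represented by the natural numbers `0, 1, 2, …` (so `i` stands for the integer `i + 1`).  A permutation
`w` has one-line notation `w 0, w 1, w 2, …`, and products are compositions of functions, so that
`w * Equiv.swap a b` exchanges the entries of `w` in positions `a` and `b`. -/

namespace Schub

/-- The group of permutations of the positive integers that fix all but finitely many of them. -/
def FinPerm : Subgroup (Equiv.Perm ℕ) where
  carrier := {w | {i | w i ≠ i}.Finite}
  one_mem' := by simp
  mul_mem' := by
    intro a b ha hb
    refine (Set.Finite.union ha hb).subset ?_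
    intro i hi
    simp only [Set.mem_ofPred_eq, Set.mem_union, Equiv.Perm.mul_apply] at *
    by_contra h
    push Not at h
    exact hi (by rw [h.2, h.1])
  inv_mem' := by
    intro a ha
    refine Set.Finite.subset ha ?_
    intro i hi h
    exact hi (by rw [Equiv.Perm.inv_eq_iff_eq]; exact h.symm)

/-- The length of a permutation: its number of inversions. -/
noncomputable def len (w : Equiv.Perm ℕ) : ℕ :=
  {p : ℕ × ℕ | p.1 < p.2 ∧ w p.2 < w p.1}.ncard

/-- The product `s_{ρ₁} s_{ρ₂} ⋯` of simple transpositions along a word. -/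
def wordProd (ρ : List ℕ) : Equiv.Perm ℕ :=
  (ρ.map fun i => Equiv.swap i (i + 1)).prod

/-- `ρ` is a reduced expression for `w`. -/
def IsReducedWord (w : Equiv.Perm ℕ) (ρ : List ℕ) : Prop :=
  wordProd ρ = w ∧ ρ.length = len w

/-- `α` is a `ρ`-compatible sequence: weakly increasing, with `α j ≤ ρ j` for all `j`, and
with `α j < α (j + 1)` whenever `ρ j < ρ (j + 1)`. -/
def IsCompatible (ρ α : List ℕ) : Prop :=
  α.length = ρ.length ∧
  (∀ j, ∀ (hα : j < α.length) (hρ : j < ρ.length), α[j] ≤ ρ[j]) ∧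
  (∀ j, ∀ (hα : j + 1 < α.length) (hρ : j + 1 < ρ.length),
    α[j] ≤ α[j + 1] ∧ (ρ[j] < ρ[j + 1] → α[j] < α[j + 1]))

/-- The Schubert polynomial of `w`: the sum, over all pairs of a reduced expression for `w` and
a compatible sequence for it, of the monomials `x_{α₁} ⋯ x_{α_ℓ}`. For `w` in `FinPerm` there are
only finitely many such pairs. -/
noncomputable def schubert (w : Equiv.Perm ℕ) : MvPolynomial ℕ ℤ :=
  ∑ᶠ p ∈ {p : List ℕ × List ℕ | IsReducedWord w p.1 ∧ IsCompatible p.1 p.2},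
    (p.2.map MvPolynomial.X).prod

/-- `c` is a family of structure constants `c^w_{u,v}`, that is,
`𝔖_u 𝔖_v = ∑_w c^w_{u,v} 𝔖_w` (a finite sum). -/
def IsStructureConstants (u v : FinPerm) (c : FinPerm →₀ ℤ) : Prop :=
  schubert u * schubert v = c.sum fun w m => m • schubert w

/-- The one-line notation of the grassmannian permutation `v(λ, k)`: the `i`-th entry is
`i + λ_{k-i+1}` in the first `k` positions, and the remaining values follow in increasing order
(see `grass_lt`); explicitly, the entry in position `k + j` is `k + j - λ'_j` for the conjugate
partition `λ'`. -/
def grassFun (lam : YoungDiagram) (k i : ℕ) : ℕ :=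
  if i < k then i + lam.rowLen (k - 1 - i) else i - lam.colLen (i - k)

theorem colLen_le (lam : YoungDiagram) (k : ℕ) (h : lam.colLen 0 ≤ k) (j : ℕ) :
    lam.colLen j ≤ k :=
  (lam.colLen_anti 0 j (Nat.zero_le j)).trans h

theorem grassFun_injective (lam : YoungDiagram) (k : ℕ) (h : lam.colLen 0 ≤ k) :
    Function.Injective (grassFun lam k) := by
  have key : ∀ i j, i < j → grassFun lam k i ≠ grassFun lam k j := by
    intro i j hij heq
    unfold grassFun at heq
    by_cases hj : j < k
    · have := lam.rowLen_anti (k - 1 - j) (k - 1 - i) (by omega)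
      rw [if_pos (by omega), if_pos hj] at heq
      omega
    · by_cases hi : i < k
      · rw [if_pos hi, if_neg hj] at heq
        have hc := colLen_le lam k h (j - k)
        have h1 := lam.mem_iff_lt_rowLen (i := k - 1 - i) (j := j - k)
        have h2 := lam.mem_iff_lt_colLen (i := k - 1 - i) (j := j - k)
        by_cases hm : (k - 1 - i, j - k) ∈ lam
        · have := h1.1 hm
          have := h2.1 hm
          omega
        · have := mt h1.2 hm
          have := mt h2.2 hm
          omega
      · rw [if_neg hi, if_neg hj] at heq
        have := lam.colLen_anti (i - k) (j - k) (by omega)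
        have := colLen_le lam k h (i - k)
        omega
  intro i j heq
  rcases lt_trichotomy i j with hlt | hlt | hlt
  · exact absurd heq (key i j hlt)
  · exact hlt
  · exact absurd heq.symm (key j i hlt)

theorem grassFun_eq_self (lam : YoungDiagram) (k i : ℕ) (hi : k + lam.rowLen 0 ≤ i) :
    grassFun lam k i = i := by
  have h0 : lam.colLen (i - k) = 0 := by
    by_contra hne
    have h1 : (0, i - k) ∈ lam := lam.mem_iff_lt_colLen.2 (Nat.pos_of_ne_zero hne)
    have := lam.mem_iff_lt_rowLen.1 h1
    omega
  unfold grassFun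
  rw [if_neg (by omega), h0, Nat.sub_zero]

theorem grassFun_bijective (lam : YoungDiagram) (k : ℕ) (h : lam.colLen 0 ≤ k) :
    Function.Bijective (grassFun lam k) := by
  refine ⟨grassFun_injective lam k h, ?_⟩
  set N := k + lam.rowLen 0 with hN
  have hmaps : Set.MapsTo (grassFun lam k) (Finset.range N : Set ℕ) (Finset.range N) := by
    intro i hi
    simp only [Finset.coe_range, Set.mem_Iio] at hi ⊢
    unfold grassFun
    split_ifs with hik
    · have := lam.rowLen_anti 0 (k - 1 - i) (Nat.zero_le _)
      omega
    · omega
  have hsurj := Finset.surjOn_of_injOn_of_card_le (s := Finset.range N) (t := Finset.range N)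
    (grassFun lam k) hmaps (grassFun_injective lam k h).injOn le_rfl
  intro i
  by_cases hi : i < N
  · obtain ⟨j, -, hj⟩ := hsurj (by simpa using hi : i ∈ (Finset.range N : Set ℕ))
    exact ⟨j, hj⟩
  · exact ⟨i, grassFun_eq_self lam k i (by omega)⟩

/-- The grassmannian permutation `v(λ, k)` of a partition `λ` with at most `k` (nonzero) parts.
The partition is given by its Young diagram, whose number of rows is `lam.colLen 0`. -/
noncomputable def grass (lam : YoungDiagram) (k : ℕ) (h : lam.colLen 0 ≤ k) : FinPerm :=
  ⟨Equiv.ofBijective (grassFun lam k) (grassFun_bijective lam k h), by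
    refine (Set.finite_lt_nat (k + lam.rowLen 0)).subset ?_
    intro i hi
    simp only [Set.mem_ofPred_eq, Equiv.ofBijective_apply] at hi ⊢
    by_contra hlt
    exact hi (grassFun_eq_self lam k i (by omega))⟩

theorem grass_apply (lam : YoungDiagram) (k : ℕ) (h : lam.colLen 0 ≤ k) (i : ℕ) (hi : i < k) :
    (grass lam k h : Equiv.Perm ℕ) i = i + lam.rowLen (k - 1 - i) := by
  simp [grass, grassFun, hi]

/-- The entries of `v(λ, k)` increase from position `k + 1` on. -/
theorem grass_lt (lam : YoungDiagram) (k : ℕ) (h : lam.colLen 0 ≤ k) (i : ℕ) (hi : k ≤ i) :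
    (grass lam k h : Equiv.Perm ℕ) i < (grass lam k h : Equiv.Perm ℕ) (i + 1) := by
  have h1 := lam.colLen_anti (i - k) (i + 1 - k) (by omega)
  have h2 := colLen_le lam k h (i - k)
  simp only [grass, grassFun, Equiv.ofBijective_apply]
  rw [if_neg (by omega), if_neg (by omega)]
  omega

/-- The product `(a₁,b₁)(a₂,b₂)⋯` of the transpositions in a list of pairs. -/
def swapProd (t : List (ℕ × ℕ)) : Equiv.Perm ℕ :=
  (t.map fun p => Equiv.swap p.1 p.2).prod

/-- `t = [(a₁,b₁), …, (aₙ,bₙ)]` is a chain of `n` steps from `u` to `w`: it satisfies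
`w = u (a₁,b₁) ⋯ (aₙ,bₙ)` with `aᵢ ≤ k < bᵢ` (as positive integers), and each step raises the length
by exactly one; in particular `ℓ(w) = ℓ(u) + n`. -/
def IsChain (k n : ℕ) (u w : FinPerm) (t : List (ℕ × ℕ)) : Prop :=
  t.length = n ∧
  (∀ p ∈ t, p.1 < k ∧ k ≤ p.2) ∧
  (w : Equiv.Perm ℕ) = u * swapProd t ∧
  ∀ i ≤ n, len (u * swapProd (t.take i)) = len u + i

end Schub

/-! Positivity comes from a Cauchy-type identity for a rectangle, and the bound by chains from
Monk's formula.

Let the nilCoxeter generators act on the free module on permutations by removing right descents. By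
Fomin and Stanley, 𝔖_w(x) is the coefficient of the identity in A_0(x_0) A_1(x_1) ⋯ applied to w
(`evalAt_schubert`). The Yang-Baxter relation moves a reversed product in variables y past this
product in x, splitting off factors 1 + (x_i + y_j) d (`revProd_mul_fsProd`). Let W exchange
adjacent blocks of lengths k and m, and put V = (1^m × u) W. On V only one term of the split product
survives, and the value is 𝔖_u(x) ∏ (x_i + y_j) (`schubert_mul_rectangle`). On the other hand, at
the coefficient of the identity the y-operators may be replaced by operators removing left descents,
which commute with the x-operators. So the same value is ∑ a_w(y) 𝔖_w(x), where a_w is zero or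
𝔖_{wV⁻¹}(y) with y_j = 0 for j ≥ m (`leftVec_apply`).

For u = 1 and g Grassmannian with descent at k, fixing all points from m + k on, the coefficient of
𝔖_g(x) is 𝔖_{gW⁻¹}(y). The functional κ in y dual to it therefore takes ∏ (x_i + y_j) to 𝔖_g(x). For
general u, applying κ gives 𝔖_u 𝔖_g = ∑ κ(a_w) 𝔖_w. By transition, setting variables to zero turns
Schubert polynomials into nonnegative combinations of Schubert polynomials (`trunc_schubert_mem`),
so κ(a_w) is a nonnegative integer (`schubert_mul_grassmannian_mem`).

Let p = x_0 + ⋯ + x_{k-1} and n = |λ|. Iterating Monk's formula, p^n 𝔖_u is the sum of the Schubert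
polynomials of the ends of chains (`exists_chains`). Also p^n is 𝔖_{v(λ,k)} plus a nonnegative
combination of Grassmannian ones (`pow_eq_schubert_add`), and 𝔖_u times that remainder is positive.
Hence c^w is at most the number of chains from u to w, and any c^w of them form the subset.
Uniqueness follows from the functionals dual to the Schubert polynomials: divided differences
followed by the constant term. -/

namespace Schub

/-! ### Identities in the nilCoxeter algebra -/

section NilCoxeter

variable {R E : Type*} [CommRing R] [Ring E] [Algebra R E]

/-- The defining relations of the nilCoxeter algebra of the infinite symmetric group. -/
structure IsNilCoxeter (d : ℕ → E) : Prop where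
  sq : ∀ i, d i * d i = 0
  comm : ∀ i j, i + 2 ≤ j → d i * d j = d j * d i
  braid : ∀ i, d i * d (i + 1) * d i = d (i + 1) * d i * d (i + 1)

/-- The factor `1 + x dᵢ`. -/
def fac (d : ℕ → E) (i : ℕ) (x : R) : E := 1 + x • d i

/-- The product `(1 + x d_{i+n-1}) ⋯ (1 + x d_{i+1}) (1 + x dᵢ)`. -/
def descProd (d : ℕ → E) : ℕ → ℕ → R → E
  | 0, _, _ => 1
  | n + 1, i, x => descProd d n (i + 1) x * fac d i x

/-- The product `(1 + x dᵢ) (1 + x d_{i+1}) ⋯ (1 + x d_{i+n-1})`. -/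
def ascProd (d : ℕ → E) : ℕ → ℕ → R → E
  | 0, _, _ => 1
  | n + 1, i, x => fac d i x * ascProd d n (i + 1) x

/-- The Fomin-Stanley product `A_a(x₀) A_{a+1}(x₁) ⋯ A_{a+k-1}(x_{k-1})`,
where `Aᵢ(x) = (1 + x d_{N-1}) ⋯ (1 + x dᵢ)`. -/
def fsProd (d : ℕ → E) (N a : ℕ) : ℕ → (ℕ → R) → E
  | 0, _ => 1
  | k + 1, x => fsProd d N a k x * descProd d (N - (a + k)) (a + k) (x k)

/-- The product `(1 + c₀ d_a) (1 + c₁ d_{a+1}) ⋯ (1 + c_{k-1} d_{a+k-1})`. -/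
def stairProd (d : ℕ → E) (a : ℕ) : ℕ → (ℕ → R) → E
  | 0, _ => 1
  | k + 1, c => stairProd d a k c * fac d (a + k) (c k)

variable {d : ℕ → E}

@[simp] theorem fac_zero (i : ℕ) : fac d i (0 : R) = 1 := by simp [fac]

@[simp] theorem descProd_zero (n i : ℕ) : descProd d n i (0 : R) = 1 := by
  induction n generalizing i with
  | zero => rfl
  | succ n ih => simp [descProd, ih]

theorem descProd_sub_succ {N i : ℕ} (h : i < N) (x : R) :
    descProd d (N - i) i x = descProd d (N - (i + 1)) (i + 1) x * fac d i x := by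
  obtain ⟨n, rfl⟩ := Nat.exists_eq_add_of_lt h
  rw [show i + n + 1 - i = n + 1 by omega, show i + n + 1 - (i + 1) = n by omega]
  rfl

theorem ascProd_sub_succ {N i : ℕ} (h : i < N) (x : R) :
    ascProd d (N - i) i x = fac d i x * ascProd d (N - (i + 1)) (i + 1) x := by
  obtain ⟨n, rfl⟩ := Nat.exists_eq_add_of_lt h
  rw [show i + n + 1 - i = n + 1 by omega, show i + n + 1 - (i + 1) = n by omega]
  rfl

section Membership

variable (P : Submonoid E)

theorem descProd_mem {n i : ℕ} {x : R} (h : ∀ j, i ≤ j → fac d j x ∈ P) :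
    descProd d n i x ∈ P := by
  induction n generalizing i with
  | zero => exact P.one_mem
  | succ n ih => exact P.mul_mem (ih fun j hj => h j (by omega)) (h i le_rfl)

theorem ascProd_mem {n i : ℕ} {x : R} (h : ∀ j, i ≤ j → fac d j x ∈ P) :
    ascProd d n i x ∈ P := by
  induction n generalizing i with
  | zero => exact P.one_mem
  | succ n ih => exact P.mul_mem (h i le_rfl) (ih fun j hj => h j (by omega))

theorem fsProd_mem {N a k : ℕ} {x : ℕ → R} (h : ∀ j, a ≤ j → ∀ y : R, fac d j y ∈ P) :
    fsProd d N a k x ∈ P := by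
  induction k with
  | zero => exact P.one_mem
  | succ k ih => exact P.mul_mem ih (descProd_mem P fun j hj => h j (by omega) _)

theorem stairProd_mem {a k : ℕ} {c : ℕ → R}
    (h : ∀ j, a ≤ j → j < a + k → ∀ y : R, fac d j y ∈ P) : stairProd d a k c ∈ P := by
  induction k with
  | zero => exact P.one_mem
  | succ k ih =>
    exact P.mul_mem (ih fun j h1 h2 => h j h1 (by omega)) (h (a + k) (by omega) (by omega) _)

end Membership

theorem commute_fac {e : E} {i : ℕ} (h : Commute e (d i)) (x : R) : Commute e (fac d i x) :=
  (Commute.one_right e).add_right (h.smul_right x)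

theorem mem_centralizer_singleton {e f : E} : f ∈ Submonoid.centralizer {e} ↔ Commute e f := by
  simp [Submonoid.mem_centralizer_iff, Commute, SemiconjBy]

theorem commute_descProd {e : E} {i : ℕ} (h : ∀ j, i ≤ j → Commute e (d j)) (n : ℕ) (x : R) :
    Commute e (descProd d n i x) :=
  mem_centralizer_singleton.1
    (descProd_mem _ fun j hj => mem_centralizer_singleton.2 (commute_fac (h j hj) x))

theorem commute_fsProd {e : E} {a : ℕ} (h : ∀ j, a ≤ j → Commute e (d j)) (N k : ℕ) (x : ℕ → R) :
    Commute e (fsProd d N a k x) :=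
  mem_centralizer_singleton.1
    (fsProd_mem _ fun j hj y => mem_centralizer_singleton.2 (commute_fac (h j hj) y))

theorem commute_stairProd {e : E} {a k : ℕ} (h : ∀ j, a ≤ j → j < a + k → Commute e (d j))
    (c : ℕ → R) : Commute e (stairProd d a k c) :=
  mem_centralizer_singleton.1
    (stairProd_mem _ fun j h1 h2 y => mem_centralizer_singleton.2 (commute_fac (h j h1 h2) y))

namespace IsNilCoxeter

variable (hd : IsNilCoxeter d)
include hd

theorem fac_mul_fac (i : ℕ) (x y : R) : fac d i x * fac d i y = fac d i (x + y) := by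
  simp only [fac, add_mul, mul_add, one_mul, mul_one, smul_mul_assoc, mul_smul_comm, hd.sq,
    smul_zero]
  module

theorem yang_baxter (i : ℕ) (x y : R) :
    fac d i x * fac d (i + 1) (x + y) * fac d i y =
      fac d (i + 1) y * fac d i (x + y) * fac d (i + 1) x := by
  simp only [fac, add_mul, mul_add, one_mul, mul_one, smul_mul_assoc, mul_smul_comm, hd.sq,
    smul_zero, hd.braid]
  module

theorem commute_d {i j : ℕ} (h : i + 2 ≤ j) : Commute (d i) (d j) := hd.comm i j h

theorem commute_fac_descProd {i j : ℕ} (h : i + 2 ≤ j) (n : ℕ) (x y : R) :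
    Commute (fac d i x) (descProd d n j y) :=
  commute_descProd (fun l hl => (commute_fac (hd.commute_d (by omega)).symm x).symm) n y

/-- The Yang-Baxter relation with parameters `x` and `y - x` rewrites the lowest factors so that the
products starting at `i + 1` stand side by side. The induction hypothesis exchanges these, and the
extra factor with parameter `-x` cancels the last factor of one of them. -/
theorem descProd_commute (n i : ℕ) (x y : R) :
    Commute (descProd d n i x) (descProd d n i y) := by
  induction n generalizing i with
  | zero => exact Commute.one_left _
  | succ n ih =>
    cases n with
    | zero =>
      change Commute (1 * fac d i x) (1 * fac d i y)
      rw [one_mul, one_mul, Commute, SemiconjBy, hd.fac_mul_fac, hd.fac_mul_fac, add_comm]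
    | succ n =>
      have key : ∀ x y : R, descProd d (n + 2) i x * descProd d (n + 2) i y =
          descProd d (n + 1) (i + 1) x * descProd d (n + 1) (i + 1) y *
            (fac d (i + 1) (-x) * fac d i y * fac d (i + 1) x * fac d i x) := by
        intro x y
        have e1 : fac d i x * fac d (i + 1) y * fac d i y =
            fac d (i + 1) y * (fac d (i + 1) (-x) * fac d i y * fac d (i + 1) x * fac d i x) := by
          have h1 : fac d i y = fac d i (y - x) * fac d i x := by
            rw [hd.fac_mul_fac]; congr 1; ring
          have h2 := hd.yang_baxter i x (y - x)
          rw [show x + (y - x) = y by ring] at h2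
          rw [← mul_assoc, ← mul_assoc, ← mul_assoc, hd.fac_mul_fac, ← sub_eq_add_neg, ← h2]
          rw [mul_assoc _ (fac d i (y - x)), ← h1]
        have h3 := (hd.commute_fac_descProd (show i + 2 ≤ i + 1 + 1 by omega) n x y).eq
        change descProd d (n + 1) (i + 1) x * fac d i x *
          (descProd d n (i + 1 + 1) y * fac d (i + 1) y * fac d i y) = descProd d (n + 1) (i + 1) x *
            (descProd d n (i + 1 + 1) y * fac d (i + 1) y) * _
        calc _ = descProd d (n + 1) (i + 1) x * (fac d i x * descProd d n (i + 1 + 1) y) *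
              (fac d (i + 1) y * fac d i y) := by noncomm_ring
          _ = descProd d (n + 1) (i + 1) x * descProd d n (i + 1 + 1) y *
              (fac d i x * fac d (i + 1) y * fac d i y) := by rw [h3]; noncomm_ring
          _ = _ := by rw [e1]; noncomm_ring
      have h4 : descProd d (n + 1) (i + 1) x * fac d (i + 1) (-x) = descProd d n (i + 1 + 1) x := by
        change descProd d n (i + 1 + 1) x * fac d (i + 1) x * fac d (i + 1) (-x) = _
        rw [mul_assoc, hd.fac_mul_fac, add_neg_cancel, fac_zero, mul_one]
      have h5 := (hd.commute_fac_descProd (show i + 2 ≤ i + 1 + 1 by omega) n y x).eq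
      rw [Commute, SemiconjBy, key, (ih (i + 1)).eq]
      calc _ = descProd d (n + 1) (i + 1) y * ((descProd d (n + 1) (i + 1) x * fac d (i + 1) (-x)) *
              fac d i y) * (fac d (i + 1) x * fac d i x) := by noncomm_ring
        _ = descProd d (n + 1) (i + 1) y * (fac d i y * descProd d n (i + 1 + 1) x) *
              (fac d (i + 1) x * fac d i x) := by rw [h4, h5]
        _ = descProd d (n + 1) (i + 1) y * fac d i y *
              (descProd d n (i + 1 + 1) x * fac d (i + 1) x * fac d i x) := by noncomm_ring

theorem ascProd_mul_descProd_neg (n i : ℕ) (x : R) :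
    ascProd d n i x * descProd d n i (-x) = 1 := by
  induction n generalizing i with
  | zero => simp [ascProd, descProd]
  | succ n ih =>
    simp only [ascProd, descProd]
    rw [mul_assoc, ← mul_assoc (ascProd d n (i + 1) x), ih, one_mul, hd.fac_mul_fac,
      add_neg_cancel, fac_zero]

theorem descProd_neg_mul_ascProd (n i : ℕ) (x : R) :
    descProd d n i (-x) * ascProd d n i x = 1 := by
  induction n generalizing i with
  | zero => simp [ascProd, descProd]
  | succ n ih =>
    simp only [ascProd, descProd]
    rw [mul_assoc, ← mul_assoc (fac d i (-x)), hd.fac_mul_fac, neg_add_cancel, fac_zero, one_mul,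
      ih]

/-- The ascending product at `y` is the inverse of the descending product at `-y`, which commutes
with the one at `x`. -/
theorem ascProd_mul_descProd (n i : ℕ) (x y : R) :
    ascProd d n i y * descProd d n i x = descProd d n i x * ascProd d n i y := by
  calc _ = ascProd d n i y * descProd d n i x * (descProd d n i (-y) * ascProd d n i y) := by
        rw [hd.descProd_neg_mul_ascProd, mul_one]
    _ = ascProd d n i y * (descProd d n i x * descProd d n i (-y)) * ascProd d n i y := by
        noncomm_ring
    _ = ascProd d n i y * descProd d n i (-y) * (descProd d n i x * ascProd d n i y) := by
        rw [(hd.descProd_commute n i x (-y)).eq]; noncomm_ring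
    _ = _ := by rw [hd.ascProd_mul_descProd_neg, one_mul]

/-- The ascending product commutes with each descending product in turn. The two lowest factors then
meet and merge, which is the source of `x j + y`. The rest of the descending product starts one
index higher and commutes with the earlier stair factors, whose indices are smaller by at least two.
-/
theorem ascProd_mul_fsProd {N a k : ℕ} (h : a + k ≤ N) (x : ℕ → R) (y : R) :
    ascProd d (N - a) a y * fsProd d N a k x =
      fsProd d N (a + 1) k x * stairProd d a k (fun j => x j + y) *
        ascProd d (N - (a + k)) (a + k) y := by
  induction k with
  | zero => simp [fsProd, stairProd]
  | succ k ih =>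
    have h1 : a + k < N := by omega
    have h2 : Commute (stairProd d a k (fun j => x j + y))
        (descProd d (N - (a + k + 1)) (a + k + 1) (x k)) :=
      (commute_stairProd (fun j _ hj => (commute_descProd (fun l hl =>
        hd.commute_d (by omega)) _ _).symm) _).symm
    simp only [fsProd, stairProd]
    rw [← mul_assoc, ih (by omega), show a + (k + 1) = a + k + 1 by ring,
      show a + 1 + k = a + k + 1 by ring]
    calc _ = fsProd d N (a + 1) k x * stairProd d a k (fun j => x j + y) *
          (ascProd d (N - (a + k)) (a + k) y * descProd d (N - (a + k)) (a + k) (x k)) := by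
          noncomm_ring
      _ = fsProd d N (a + 1) k x * (stairProd d a k (fun j => x j + y) *
          descProd d (N - (a + k + 1)) (a + k + 1) (x k)) *
          ((fac d (a + k) (x k) * fac d (a + k) y) *
            ascProd d (N - (a + k + 1)) (a + k + 1) y) := by
          rw [hd.ascProd_mul_descProd, descProd_sub_succ h1, ascProd_sub_succ h1]; noncomm_ring
      _ = _ := by rw [h2.eq, hd.fac_mul_fac]; noncomm_ring

/-- The divided difference of the Fomin-Stanley product. -/
theorem fsProd_sub_swap {N i : ℕ} (x : ℕ → R) (k : ℕ) (hk : i + 2 ≤ k) (hN : k ≤ N) :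
    fsProd d N 0 k x - fsProd d N 0 k (x ∘ Equiv.swap i (i + 1)) =
      (x i - x (i + 1)) • (fsProd d N 0 k x * d i) := by
  have low : ∀ j ≤ i, fsProd d N 0 j (x ∘ Equiv.swap i (i + 1)) = fsProd d N 0 j x := by
    intro j hj
    induction j with
    | zero => rfl
    | succ j ih =>
      simp only [fsProd, Function.comp]
      rw [ih (by omega), Equiv.swap_apply_of_ne_of_ne (by omega) (by omega)]
  induction k, hk using Nat.le_induction with
  | base =>
    simp only [fsProd, Function.comp, low i le_rfl, Equiv.swap_apply_left, Equiv.swap_apply_right,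
      zero_add]
    -- With the second product started at `i` as well, the two products are symmetric in the
    -- variables `x i` and `x (i + 1)`, and only the correcting last factor changes under the
    -- exchange.
    have h1 : ∀ z : R, descProd d (N - (i + 1)) (i + 1) z =
        descProd d (N - i) i z * fac d i (-z) := by
      intro z
      rw [descProd_sub_succ (by omega : i < N), mul_assoc, hd.fac_mul_fac, add_neg_cancel,
        fac_zero, mul_one]
    rw [h1, h1, mul_assoc, mul_assoc, ← mul_assoc (descProd d (N - i) i (x (i + 1))),
      (hd.descProd_commute (N - i) i (x (i + 1)) (x i)).eq, ← mul_sub, ← mul_assoc, ← mul_sub]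
    have h2 : fac d i (-x (i + 1)) * d i = d i := by simp [fac, add_mul, hd.sq]
    have h3 : fac d i (-x (i + 1)) - fac d i (-x i) = (x i - x (i + 1)) • d i := by
      simp only [fac]; module
    simp only [mul_assoc, h2, h3, mul_smul_comm]
  | succ k hk ih =>
    have h1 : Commute (d i) (descProd d (N - k) k (x k)) :=
      commute_descProd (fun j hj => hd.commute_d (by omega)) _ _
    simp only [fsProd, Function.comp, zero_add]
    rw [Equiv.swap_apply_of_ne_of_ne (by omega) (by omega), mul_assoc, ← h1.eq, ← mul_assoc,
      ← smul_mul_assoc, ← ih (by omega), sub_mul]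

end IsNilCoxeter

/-- The product `Ã_{m-1}(y_{m-1}) ⋯ Ã₁(y₁) Ã₀(y₀)`, where `Ãᵢ(y) = (1 + y dᵢ) ⋯ (1 + y d_{N-1})`. -/
def revProd (d : ℕ → E) (N : ℕ) : ℕ → (ℕ → R) → E
  | 0, _ => 1
  | m + 1, y => ascProd d (N - m) m (y m) * revProd d N m y

/-- The product of the factors split off by `revProd_mul_fsProd`. -/
def rectProd (d : ℕ → E) (N k : ℕ) (x : ℕ → R) : ℕ → (ℕ → R) → E
  | 0, _ => 1
  | m + 1, y => stairProd d m k (fun j => x j + y m) *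
      ascProd d (N - (m + k)) (m + k) (y m) * rectProd d N k x m y

theorem IsNilCoxeter.revProd_mul_fsProd (hd : IsNilCoxeter d) {N m k : ℕ} (h : m + k ≤ N)
    (x y : ℕ → R) :
    revProd d N m y * fsProd d N 0 k x = fsProd d N m k x * rectProd d N k x m y := by
  induction m with
  | zero => simp [revProd, rectProd]
  | succ m ih =>
    simp only [revProd, rectProd]
    rw [mul_assoc, ih (by omega), ← mul_assoc, hd.ascProd_mul_fsProd (by omega)]
    simp only [mul_assoc]

end NilCoxeter

end Schub

/-! ### Length, reduced words and Bruhat covers -/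

namespace Schub

open Equiv

/-- The inversions of a permutation. -/
def inversions (w : Perm ℕ) : Set (ℕ × ℕ) := {p | p.1 < p.2 ∧ w p.2 < w p.1}

theorem len_eq_ncard (w : Perm ℕ) : len w = (inversions w).ncard := rfl

theorem exists_fixed_bound {w : Perm ℕ} (hw : w ∈ FinPerm) : ∃ N, ∀ i, N ≤ i → w i = i := by
  obtain ⟨N, hN⟩ := (show {i | w i ≠ i}.Finite from hw).bddAbove
  refine ⟨N + 1, fun i hi => ?_⟩
  by_contra h
  have := hN (show i ∈ {i | w i ≠ i} from h)
  omega

theorem mem_finPerm_of_fixed {w : Perm ℕ} {N : ℕ} (h : ∀ i, N ≤ i → w i = i) : w ∈ FinPerm := by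
  refine (Set.finite_lt_nat N).subset fun i hi => ?_
  by_contra hlt
  exact hi (h i (by simpa using hlt))

theorem lt_of_fixed {w : Perm ℕ} {N : ℕ} (h : ∀ i, N ≤ i → w i = i) {i : ℕ} (hi : i < N) :
    w i < N := by
  by_contra hle
  have h1 := h (w i) (by omega)
  have := w.injective h1
  omega

theorem lt_of_descent {w : Perm ℕ} {N : ℕ} (hN : ∀ i, N ≤ i → w i = i) {i : ℕ}
    (h : w (i + 1) < w i) : i + 1 < N := by
  by_contra hi
  have h1 := hN (i + 1) (by omega)
  by_cases h2 : N ≤ i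
  · have := hN i h2
    omega
  · have := lt_of_fixed hN (show i < N by omega)
    omega

theorem fixed_mul_swap {w : Perm ℕ} {N : ℕ} (hN : ∀ i, N ≤ i → w i = i) {a b : ℕ}
    (ha : a < N) (hb : b < N) : ∀ i, N ≤ i → (w * swap a b) i = i := fun i hi => by
  rw [Perm.mul_apply, swap_apply_of_ne_of_ne (by omega) (by omega), hN i hi]

theorem inversions_finite {w : Perm ℕ} (hw : w ∈ FinPerm) : (inversions w).Finite := by
  obtain ⟨N, hN⟩ := exists_fixed_bound hw
  refine ((Set.finite_lt_nat N).prod (Set.finite_lt_nat N)).subset ?_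
  rintro ⟨a, b⟩ ⟨h1, h2⟩
  simp only at h1 h2
  suffices b < N from ⟨(by change a < N; omega), this⟩
  by_contra hb
  have hb' := hN b (by omega)
  by_cases ha : a < N
  · have := lt_of_fixed hN ha
    omega
  · have := hN a (by omega)
    omega

theorem swap_mem (a b : ℕ) : swap a b ∈ FinPerm :=
  mem_finPerm_of_fixed (N := a + b + 1) fun i hi =>
    swap_apply_of_ne_of_ne (by omega) (by omega)

theorem mul_swap_mem {w : Perm ℕ} (hw : w ∈ FinPerm) (a b : ℕ) : w * swap a b ∈ FinPerm :=
  FinPerm.mul_mem hw (swap_mem a b)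

theorem mul_swap_swap (w : Perm ℕ) (a b : ℕ) : w * swap a b * swap a b = w := by
  rw [mul_assoc, swap_mul_self, mul_one]

theorem swap_adj_lt {i a b : ℕ} (hab : a < b) (h : ¬ (a = i ∧ b = i + 1)) :
    swap i (i + 1) a < swap i (i + 1) b := by
  simp only [swap_apply_def]
  split_ifs <;> omega

theorem inversions_mul_swap {w : Perm ℕ} {i : ℕ} (h : w i < w (i + 1)) :
    inversions (w * swap i (i + 1)) =
      insert (i, i + 1) (Prod.map (swap i (i + 1)) (swap i (i + 1)) '' inversions w) := by
  ext ⟨a, b⟩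
  simp only [inversions, Set.mem_ofPred_eq, Set.mem_insert_iff, Set.mem_image, Prod.exists,
    Prod.map_apply, Prod.mk.injEq, Perm.mul_apply]
  constructor
  · rintro ⟨h1, h2⟩
    by_cases hab : a = i ∧ b = i + 1
    · exact Or.inl hab
    · exact Or.inr ⟨_, _, ⟨swap_adj_lt h1 hab, h2⟩, by simp, by simp⟩
  · rintro (⟨rfl, rfl⟩ | ⟨c, e, ⟨h1, h2⟩, rfl, rfl⟩)
    · simpa using h
    · refine ⟨swap_adj_lt h1 ?_, by simpa using h2⟩
      rintro ⟨rfl, rfl⟩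
      omega

theorem len_mul_swap_of_lt {w : Perm ℕ} (hw : w ∈ FinPerm) {i : ℕ} (h : w i < w (i + 1)) :
    len (w * swap i (i + 1)) = len w + 1 := by
  rw [len_eq_ncard, len_eq_ncard, inversions_mul_swap h, Set.ncard_insert_of_notMem ?_ ((inversions_finite hw).image _),
    Set.ncard_image_of_injective _ ((Equiv.injective _).prodMap (Equiv.injective _))]
  · rintro ⟨⟨a, b⟩, ⟨h1, h2⟩, h3⟩
    simp only [Prod.map_apply, Prod.mk.injEq] at h3 h1 h2
    obtain ⟨h3, h4⟩ := h3
    rw [swap_apply_eq_iff] at h3 h4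
    simp at h3 h4
    omega

theorem len_mul_swap_of_gt {w : Perm ℕ} (hw : w ∈ FinPerm) {i : ℕ} (h : w (i + 1) < w i) :
    len (w * swap i (i + 1)) + 1 = len w := by
  have := len_mul_swap_of_lt (w := w * swap i (i + 1)) (i := i) (mul_swap_mem hw _ _)
    (by simpa using h)
  rw [mul_swap_swap] at this
  exact this.symm

theorem lt_or_gt_adj (w : Perm ℕ) (i : ℕ) : w i < w (i + 1) ∨ w (i + 1) < w i :=
  lt_or_gt_of_ne fun h => by simpa using w.injective h

@[simp] theorem len_one : len 1 = 0 := by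
  have : inversions 1 = ∅ := by
    ext p
    simp only [inversions, Set.mem_ofPred_eq, Perm.one_apply, Set.mem_empty_iff_false, iff_false]
    omega
  rw [len_eq_ncard, this, Set.ncard_empty]

theorem eq_one_of_increasing {w : Perm ℕ} (h : ∀ i, w i < w (i + 1)) : w = 1 := by
  have h1 : StrictMono w := strictMono_nat_of_lt_succ h
  have h2 : StrictMono (w⁻¹ : Perm ℕ) := fun a b hab => by
    rw [← h1.lt_iff_lt]
    simpa using hab
  ext i
  have h3 := h1.le_apply (x := i)
  have h4 := h2.le_apply (x := w i)
  simp at h4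
  simp
  omega

/-- Induction on the length: a permutation is the identity or has a descent. -/
@[elab_as_elim]
theorem finPerm_induction {p : Perm ℕ → Prop} (one : p 1)
    (step : ∀ w ∈ FinPerm, ∀ i, w (i + 1) < w i → p (w * swap i (i + 1)) → p w)
    (w : Perm ℕ) (hw : w ∈ FinPerm) : p w := by
  induction hn : len w generalizing w with
  | zero =>
    have : w = 1 := eq_one_of_increasing fun i => by
      rcases lt_or_gt_adj w i with h | h
      · exact h
      · have := len_mul_swap_of_gt hw h
        omega
    rwa [this]
  | succ n ih =>
    by_cases h : ∀ i, w i < w (i + 1)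
    · rwa [eq_one_of_increasing h]
    · push Not at h
      obtain ⟨i, hi⟩ := h
      have hi' : w (i + 1) < w i := (lt_or_gt_adj w i).resolve_left (by omega)
      refine step w hw i hi' (ih _ (mul_swap_mem hw _ _) ?_)
      have := len_mul_swap_of_gt hw hi'
      omega

theorem wordProd_append_singleton (ρ : List ℕ) (i : ℕ) :
    wordProd (ρ ++ [i]) = wordProd ρ * swap i (i + 1) := by
  simp [wordProd]

theorem wordProd_mem (ρ : List ℕ) : wordProd ρ ∈ FinPerm :=
  FinPerm.list_prod_mem fun x hx => by
    obtain ⟨i, -, rfl⟩ := List.mem_map.1 hx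
    exact swap_mem _ _

theorem len_wordProd_le (ρ : List ℕ) : len (wordProd ρ) ≤ ρ.length := by
  induction ρ using List.reverseRecOn with
  | nil => simp [wordProd]
  | append_singleton ρ i ih =>
    rw [wordProd_append_singleton]
    rcases lt_or_gt_adj (wordProd ρ) i with h | h
    · rw [len_mul_swap_of_lt (wordProd_mem ρ) h]
      simpa using ih
    · have := len_mul_swap_of_gt (wordProd_mem ρ) h
      simp
      omega

theorem isReducedWord_append_iff {w : Perm ℕ} (hw : w ∈ FinPerm) (ρ : List ℕ) (i : ℕ) :
    IsReducedWord w (ρ ++ [i]) ↔ w (i + 1) < w i ∧ IsReducedWord (w * swap i (i + 1)) ρ := by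
  have hmul : wordProd (ρ ++ [i]) = w ↔ wordProd ρ = w * swap i (i + 1) := by
    rw [wordProd_append_singleton]
    constructor
    · rintro rfl
      rw [mul_swap_swap]
    · intro h
      rw [h, mul_swap_swap]
  unfold IsReducedWord
  rw [hmul, List.length_append, List.length_singleton]
  constructor
  · rintro ⟨h1, h2⟩
    rcases lt_or_gt_adj w i with h | h
    · have h3 := len_mul_swap_of_lt hw h
      have h4 := len_wordProd_le ρ
      rw [h1] at h4
      omega
    · have h3 := len_mul_swap_of_gt hw h
      exact ⟨h, h1, by omega⟩
  · rintro ⟨h, h1, h2⟩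
    have h3 := len_mul_swap_of_gt hw h
    exact ⟨h1, by omega⟩

/-- `w` is increasing from position `m` on. -/
def IncrFrom (m : ℕ) (w : Perm ℕ) : Prop := ∀ i, m ≤ i → w i < w (i + 1)

theorem IncrFrom.lt {m : ℕ} {w : Perm ℕ} (h : IncrFrom m w) {a b : ℕ} (ha : m ≤ a) (hab : a < b) :
    w a < w b := by
  induction b, hab using Nat.le_induction with
  | base => exact h a ha
  | succ b hb ih => exact ih.trans (h b (by omega))

/-- The pairs of positions whose exchange is a cover in the Bruhat order. -/
def IsCover (w : Perm ℕ) (a b : ℕ) : Prop :=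
  a < b ∧ w a < w b ∧ ∀ c, a < c → c < b → w c < w a ∨ w b < w c

theorem isCover_adj_iff (w : Perm ℕ) (i : ℕ) : IsCover w i (i + 1) ↔ w i < w (i + 1) :=
  ⟨fun h => h.2.1, fun h => ⟨by omega, h, fun c h1 h2 => by omega⟩⟩

/-- Conjugation by the adjacent transposition at `a` reduces the exchange of `a` and `b` to that of
`a + 1` and `b`. Since the entry at `a + 1` does not lie between the two exchanged values, the two
adjacent multiplications change the length in opposite directions. -/
theorem IsCover.len_mul_swap {w : Perm ℕ} (hw : w ∈ FinPerm) {a b : ℕ} (h : IsCover w a b) :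
    len (w * swap a b) = len w + 1 := by
  obtain ⟨n, rfl⟩ := Nat.exists_eq_add_of_lt h.1
  induction n generalizing w a with
  | zero => exact len_mul_swap_of_lt hw h.2.1
  | succ n ih =>
    obtain ⟨-, h2, h3⟩ := h
    have hb : a + (n + 1) + 1 = a + 1 + n + 1 := by omega
    rw [hb] at h2 h3 ⊢
    set b := a + 1 + n + 1 with hbdef
    set v := w * swap a (a + 1) with hv
    have hvmem : v ∈ FinPerm := mul_swap_mem hw _ _
    have va : v a = w (a + 1) := by simp [v]
    have va1 : v (a + 1) = w a := by simp [v]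
    have vc : ∀ c, a + 1 < c → v c = w c := fun c hc => by
      simp [v, swap_apply_of_ne_of_ne (show c ≠ a by omega) (show c ≠ a + 1 by omega)]
    have hcov : IsCover v (a + 1) b := by
      refine ⟨by omega, ?_, fun c h4 h5 => ?_⟩
      · rw [va1, vc b (by omega)]
        exact h2
      · rw [va1, vc b (by omega), vc c (by omega)]
        exact h3 c (by omega) h5
    have key : v * swap (a + 1) b * swap a (a + 1) = w * swap a b := by
      rw [hv, mul_assoc, mul_assoc, ← mul_assoc (swap a (a + 1))]
      congr 1
      rw [swap_comm (a + 1) b, swap_comm a (a + 1),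
        swap_mul_swap_mul_swap (show b ≠ a + 1 by omega) (show b ≠ a by omega), swap_comm]
    have hlen : len (v * swap (a + 1) b) = len v + 1 := ih hvmem hcov
    have ua : (v * swap (a + 1) b) a = w (a + 1) := by
      rw [Perm.mul_apply, swap_apply_of_ne_of_ne (by omega) (by omega), va]
    have ua1 : (v * swap (a + 1) b) (a + 1) = w b := by
      rw [Perm.mul_apply, swap_apply_left, vc b (by omega)]
    have humem : v * swap (a + 1) b ∈ FinPerm := mul_swap_mem hvmem _ _
    rw [← key]
    rcases h3 (a + 1) (by omega) (by omega) with h4 | h4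
    · have h5 := len_mul_swap_of_gt hw h4
      have h6 := len_mul_swap_of_lt humem (i := a) (by rw [ua, ua1]; omega)
      rw [← hv] at h5
      omega
    · have h5 := len_mul_swap_of_lt hw (show w a < w (a + 1) by omega)
      have h6 := len_mul_swap_of_gt humem (i := a) (by rw [ua, ua1]; omega)
      rw [← hv] at h5
      omega

end Schub

/-! ### Right and left descent operators -/

namespace Schub

open Equiv

section Operators

variable (R : Type*) [CommRing R]

/-- The free module on all permutations. -/
abbrev PermModule := Perm ℕ →₀ R

/-- The basis vector of a permutation. -/
noncomputable abbrev basisVec (w : Perm ℕ) : PermModule R := Finsupp.single w 1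

/-- The operator that removes a right descent. -/
noncomputable def dOp (i : ℕ) : Module.End R (PermModule R) :=
  Finsupp.linearCombination R fun w : Perm ℕ =>
    if w (i + 1) < w i then basisVec R (w * swap i (i + 1)) else 0

/-- Inversion of permutations, extended linearly. -/
noncomputable def invOp : Module.End R (PermModule R) :=
  Finsupp.linearCombination R fun w : Perm ℕ => basisVec R w⁻¹

/-- The operator that removes a left descent. -/
noncomputable def dLeft (i : ℕ) : Module.End R (PermModule R) := invOp R * dOp R i * invOp R

/-- The coefficient of the identity. -/
noncomputable def coeffOne : PermModule R →ₗ[R] R := Finsupp.lapply 1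

variable {R}

theorem dOp_basisVec (i : ℕ) (w : Perm ℕ) : dOp R i (basisVec R w) =
    if w (i + 1) < w i then basisVec R (w * swap i (i + 1)) else 0 := by
  simp [dOp]

theorem dOp_of_gt {i : ℕ} {w : Perm ℕ} (h : w (i + 1) < w i) :
    dOp R i (basisVec R w) = basisVec R (w * swap i (i + 1)) := by
  rw [dOp_basisVec, if_pos h]

theorem dOp_of_lt {i : ℕ} {w : Perm ℕ} (h : w i < w (i + 1)) : dOp R i (basisVec R w) = 0 := by
  rw [dOp_basisVec, if_neg (by omega)]

@[simp] theorem invOp_basisVec (w : Perm ℕ) : invOp R (basisVec R w) = basisVec R w⁻¹ := by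
  simp [invOp]

theorem end_ext {f g : Module.End R (PermModule R)}
    (h : ∀ w, f (basisVec R w) = g (basisVec R w)) : f = g :=
  Finsupp.lhom_ext' fun w => LinearMap.ext_ring (h w)

theorem linear_ext {M : Type*} [AddCommGroup M] [Module R M] {f g : PermModule R →ₗ[R] M}
    (h : ∀ w, f (basisVec R w) = g (basisVec R w)) : f = g :=
  Finsupp.lhom_ext' fun w => LinearMap.ext_ring (h w)

@[simp] theorem invOp_mul_invOp : invOp R * invOp R = 1 :=
  end_ext fun w => by simp

theorem dLeft_basisVec (i : ℕ) (w : Perm ℕ) : dLeft R i (basisVec R w) =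
    if w⁻¹ (i + 1) < w⁻¹ i then basisVec R (swap i (i + 1) * w) else 0 := by
  simp only [dLeft, Module.End.mul_apply, invOp_basisVec, dOp_basisVec]
  split_ifs
  · simp [mul_inv_rev]
  · simp

open Classical in
theorem coeffOne_basisVec (w : Perm ℕ) : coeffOne R (basisVec R w) = if w = 1 then 1 else 0 := by
  simp [coeffOne, Finsupp.single_apply]

theorem coeffOne_invOp (v : PermModule R) : coeffOne R (invOp R v) = coeffOne R v := by
  refine LinearMap.congr_fun (f := (coeffOne R).comp (invOp R)) (linear_ext fun w => ?_) v
  simp only [LinearMap.comp_apply, invOp_basisVec, coeffOne_basisVec]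
  by_cases h : w = 1
  · rw [if_pos h, if_pos (by rw [h, inv_one])]
  · rw [if_neg h, if_neg (fun h' => h (inv_eq_one.1 h'))]

theorem swap_braid (i : ℕ) : swap i (i + 1) * swap (i + 1) (i + 2) * swap i (i + 1) =
    swap (i + 1) (i + 2) * swap i (i + 1) * swap (i + 1) (i + 2) := by
  rw [swap_mul_swap_mul_swap (by omega) (by omega), swap_comm i (i + 1),
    swap_comm (i + 1) (i + 2), swap_mul_swap_mul_swap (by omega) (by omega), swap_comm]

theorem isNilCoxeter_dOp : IsNilCoxeter (dOp R) where
  sq i := end_ext fun w => by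
    rcases lt_or_gt_adj w i with h | h
    · simp [dOp_of_lt h]
    · rw [Module.End.mul_apply, dOp_of_gt h, dOp_of_lt (by simpa using h)]
      rfl
  comm i j hij := end_ext fun w => by
    have e1 : ∀ k, k = j ∨ k = j + 1 → (w * swap i (i + 1)) k = w k := fun k hk => by
      rw [Perm.mul_apply, swap_apply_of_ne_of_ne (by omega) (by omega)]
    have e2 : ∀ k, k = i ∨ k = i + 1 → (w * swap j (j + 1)) k = w k := fun k hk => by
      rw [Perm.mul_apply, swap_apply_of_ne_of_ne (by omega) (by omega)]
    have e3 : swap i (i + 1) * swap j (j + 1) = swap j (j + 1) * swap i (i + 1) := by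
      refine (Perm.Disjoint.commute fun k => ?_).eq
      simp only [swap_apply_def]
      split_ifs <;> omega
    simp only [Module.End.mul_apply, dOp_basisVec, apply_ite (dOp R _), map_zero,
      e1 _ (Or.inl rfl), e1 _ (Or.inr rfl), e2 _ (Or.inl rfl), e2 _ (Or.inr rfl), mul_assoc, e3]
    split_ifs <;> rfl
  braid i := end_ext fun w => by
    have s1 : swap i (i + 1) (i + 2) = i + 2 := swap_apply_of_ne_of_ne (by omega) (by omega)
    have s2 : swap (i + 1) (i + 2) i = i := swap_apply_of_ne_of_ne (by omega) (by omega)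
    have hb := swap_braid i
    simp only [mul_assoc] at hb
    simp only [Module.End.mul_apply, dOp_basisVec, apply_ite (dOp R _), map_zero, Perm.mul_apply,
      swap_apply_left, swap_apply_right, s1, s2, mul_assoc, hb, show i + 1 + 1 = i + 2 from rfl]
    split_ifs <;> rfl

/-- Exchanging the values `j` and `j + 1` affects a descent at `i` only if these values occupy the
positions `i` and `i + 1`. In that case both operators exchange the same two entries, and either
composite is zero. -/
theorem dOp_commute_dLeft (i j : ℕ) : Commute (dOp R i) (dLeft R j) := by
  refine end_ext fun w => ?_
  simp only [Module.End.mul_apply, dOp_basisVec, dLeft_basisVec, apply_ite (dOp R _),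
    apply_ite (dLeft R _), map_zero, Perm.mul_apply, mul_inv_rev, swap_inv, mul_assoc]
  by_cases h : w⁻¹ j = i ∧ w⁻¹ (j + 1) = i + 1 ∨ w⁻¹ j = i + 1 ∧ w⁻¹ (j + 1) = i
  · rcases h with ⟨h1, h2⟩ | ⟨h1, h2⟩
    · have h3 := (Perm.inv_eq_iff_eq.1 h1).symm
      have h4 := (Perm.inv_eq_iff_eq.1 h2).symm
      simp [h1, h2, h3, h4]
    · have h3 := (Perm.inv_eq_iff_eq.1 h1).symm
      have h4 := (Perm.inv_eq_iff_eq.1 h2).symm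
      simp [h1, h2, h3, h4]
  · have h' : ¬ (w i = j ∧ w (i + 1) = j + 1 ∨ w i = j + 1 ∧ w (i + 1) = j) := by
      simp only [Perm.inv_eq_iff_eq] at h
      omega
    have e1 : swap j (j + 1) (w (i + 1)) < swap j (j + 1) (w i) ↔ w (i + 1) < w i := by
      have hne := w.injective.ne (show i ≠ i + 1 by omega)
      rcases lt_or_gt_of_ne hne with hl | hl
      · have := swap_adj_lt (i := j) hl (by omega)
        omega
      · have := swap_adj_lt (i := j) hl (by omega)
        omega
    have e2 : swap i (i + 1) (w⁻¹ (j + 1)) < swap i (i + 1) (w⁻¹ j) ↔ w⁻¹ (j + 1) < w⁻¹ j := by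
      have hne := w⁻¹.injective.ne (show j ≠ j + 1 by omega)
      rcases lt_or_gt_of_ne hne with hl | hl
      · have := swap_adj_lt (i := i) hl (by omega)
        omega
      · have := swap_adj_lt (i := i) hl (by omega)
        omega
    simp only [e1, e2]
    split_ifs <;> rfl

/-- Either operator reaches the identity only from the simple transposition itself. -/
theorem coeffOne_dOp (i : ℕ) (v : PermModule R) :
    coeffOne R (dOp R i v) = coeffOne R (dLeft R i v) := by
  refine LinearMap.congr_fun (f := (coeffOne R).comp (dOp R i))
    (g := (coeffOne R).comp (dLeft R i)) (linear_ext fun w => ?_) v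
  simp only [LinearMap.comp_apply, dOp_basisVec, dLeft_basisVec, apply_ite (coeffOne R),
    coeffOne_basisVec, map_zero]
  by_cases h : w = swap i (i + 1)
  · subst h
    simp
  · have h1 : w * swap i (i + 1) ≠ 1 := fun h' => h (by
      rw [mul_eq_one_iff_eq_inv, swap_inv] at h'; exact h')
    have h2 : swap i (i + 1) * w ≠ 1 := fun h' => h (by
      rw [mul_eq_one_iff_inv_eq, swap_inv] at h'; exact h'.symm)
    rw [if_neg h1, if_neg h2, ite_self, ite_self]

theorem fac_commute (i j : ℕ) (x y : R) : Commute (fac (dOp R) i x) (fac (dLeft R) j y) :=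
  commute_fac (commute_fac (dOp_commute_dLeft i j).symm x).symm y

theorem coeffOne_fac (i : ℕ) (y : R) (v : PermModule R) :
    coeffOne R (fac (dOp R) i y v) = coeffOne R (fac (dLeft R) i y v) := by
  simp only [fac, LinearMap.add_apply, LinearMap.smul_apply, map_add, map_smul, coeffOne_dOp]

/-- In front of the other factors a right operator may be turned into a left one, which then
commutes past all remaining right operators. This is what reverses the order of the factors. -/
theorem coeffOne_ascProd (n i : ℕ) (y : R) (v : PermModule R) :
    coeffOne R (ascProd (dOp R) n i y v) = coeffOne R (descProd (dLeft R) n i y v) := by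
  induction n generalizing i v with
  | zero => rfl
  | succ n ih =>
    have h : Commute (fac (dLeft R) i y) (ascProd (dOp R) n (i + 1) y) :=
      mem_centralizer_singleton.1 (ascProd_mem _ fun j _ =>
        mem_centralizer_singleton.2 (fac_commute j i y y).symm)
    simp only [ascProd, descProd, Module.End.mul_apply]
    rw [coeffOne_fac, ← Module.End.mul_apply, h.eq, Module.End.mul_apply, ih]

theorem coeffOne_revProd (N m : ℕ) (y : ℕ → R) (v : PermModule R) :
    coeffOne R (revProd (dOp R) N m y v) = coeffOne R (fsProd (dLeft R) N 0 m y v) := by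
  induction m generalizing v with
  | zero => rfl
  | succ m ih =>
    have h1 : ∀ (n i : ℕ) (z : R), Commute (descProd (dLeft R) (N - m) m (y m))
        (ascProd (dOp R) n i z) := fun n i z =>
      mem_centralizer_singleton.1 (ascProd_mem _ fun j _ => mem_centralizer_singleton.2
        (commute_fac (commute_descProd (fun l _ => dOp_commute_dLeft j l) _ _).symm z))
    have h2 : ∀ l, Commute (descProd (dLeft R) (N - m) m (y m)) (revProd (dOp R) N l y) := by
      intro l
      induction l with
      | zero => exact Commute.one_right _
      | succ l ihl => exact (h1 _ _ _).mul_right ihl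
    simp only [revProd, fsProd, zero_add, Module.End.mul_apply]
    rw [coeffOne_ascProd, ← Module.End.mul_apply, (h2 m).eq, Module.End.mul_apply, ih]

theorem fsProd_dLeft (N a k : ℕ) (x : ℕ → R) :
    fsProd (dLeft R) N a k x = invOp R * fsProd (dOp R) N a k x * invOp R := by
  have hJ : ∀ S T : Module.End R (PermModule R),
      invOp R * S * invOp R * (invOp R * T * invOp R) = invOp R * (S * T) * invOp R := by
    intro S T
    calc _ = invOp R * S * (invOp R * invOp R) * T * invOp R := by noncomm_ring
      _ = _ := by rw [invOp_mul_invOp]; noncomm_ring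
  have h1 : ∀ i (z : R), fac (dLeft R) i z = invOp R * fac (dOp R) i z * invOp R := by
    intro i z
    simp [fac, dLeft, mul_add, add_mul]
  have h2 : ∀ n i (z : R), descProd (dLeft R) n i z = invOp R * descProd (dOp R) n i z * invOp R := by
    intro n
    induction n with
    | zero => intro i z; simp [descProd]
    | succ n ih => intro i z; simp only [descProd, ih, h1, hJ]
  induction k with
  | zero => simp [fsProd]
  | succ k ih => simp only [fsProd, ih, h2, hJ]

/-- The right descent operators that extract the coefficient of `v`. -/
theorem exists_coeff_operator (v : Perm ℕ) (hv : v ∈ FinPerm) :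
    ∃ T : Module.End R (PermModule R),
      (∀ j, Commute T (dLeft R j)) ∧
      (∀ X, coeffOne R (T X) = X v) ∧
      (∀ w, T (basisVec R w) = 0 ∨ T (basisVec R w) = basisVec R (w * v⁻¹)) ∧
      (∀ w, inversions v ⊆ inversions w → T (basisVec R w) = basisVec R (w * v⁻¹)) := by
  refine finPerm_induction ?_ ?_ v hv
  · exact ⟨1, fun j => Commute.one_left _, fun X => rfl, fun w => Or.inr (by simp),
      fun w _ => by simp⟩
  rintro v hv i hi ⟨T, h1, h2, h3, h4⟩
  have e : ∀ w : Perm ℕ, w * swap i (i + 1) * (v * swap i (i + 1))⁻¹ = w * v⁻¹ := fun w => by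
    rw [mul_inv_rev, swap_inv, mul_assoc, ← mul_assoc (swap i (i + 1)), swap_mul_self, one_mul]
  classical
  -- The operator is the product of right descent operators along a reduced word of `v`.
  refine ⟨T * dOp R i, fun j => (h1 j).mul_left (dOp_commute_dLeft i j), ?_, fun w => ?_, ?_⟩
  · intro X
    refine LinearMap.congr_fun (f := (coeffOne R).comp (T * dOp R i)) (g := Finsupp.lapply v)
      (linear_ext fun w => ?_) X
    simp only [LinearMap.comp_apply, Module.End.mul_apply, Finsupp.lapply_apply]
    rcases lt_or_gt_adj w i with h | h
    · rw [dOp_of_lt h, map_zero, map_zero, Finsupp.single_apply, if_neg]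
      rintro rfl
      omega
    · rw [dOp_of_gt h, h2, Finsupp.single_apply, Finsupp.single_apply]
      simp only [mul_left_inj]
  · rw [Module.End.mul_apply]
    rcases lt_or_gt_adj w i with h | h
    · left
      rw [dOp_of_lt h, map_zero]
    · rw [dOp_of_gt h, ← e w]
      exact h3 _
  -- Containment of the inversion sets persists when the descent `i` is removed from both
  -- permutations, so no operator of the product meets an ascent.
  · intro w hw
    have h : w (i + 1) < w i := (hw (show (i, i + 1) ∈ inversions v from ⟨by simp, hi⟩)).2
    rw [Module.End.mul_apply, dOp_of_gt h, ← e w]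
    refine h4 _ ?_
    rintro ⟨a, b⟩ ⟨hab, hv'⟩
    simp only [Perm.mul_apply] at hab hv'
    have hne : ¬ (a = i ∧ b = i + 1) := by
      rintro ⟨rfl, rfl⟩
      simp at hv'
      omega
    exact ⟨hab, (hw (show (_, _) ∈ inversions v from ⟨swap_adj_lt hab hne, hv'⟩)).2⟩

/-- The operators preserving the span of a set of permutations. -/
def stableSubmonoid (R : Type*) [CommRing R] (S : Set (Perm ℕ)) :
    Submonoid (Module.End R (PermModule R)) where
  carrier := {T | ∀ Y ∈ Finsupp.supported R R S, T Y ∈ Finsupp.supported R R S}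
  one_mem' := fun _ hY => hY
  mul_mem' := fun hf hg Y hY => hf _ (hg Y hY)

theorem fac_mem_stableSubmonoid {S : Set (Perm ℕ)} {d : ℕ → Module.End R (PermModule R)} {i : ℕ}
    (h : ∀ w ∈ S, d i (basisVec R w) ∈ Finsupp.supported R R S) (y : R) :
    fac d i y ∈ stableSubmonoid R S := by
  intro Y hY
  rw [fac, LinearMap.add_apply, LinearMap.smul_apply]
  refine Submodule.add_mem _ hY (Submodule.smul_mem _ _ ?_)
  rw [Finsupp.supported_eq_span_single] at hY
  induction hY using Submodule.span_induction with
  | zero => simp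
  | add a b _ _ ha hb => rw [map_add]; exact Submodule.add_mem _ ha hb
  | smul c a _ ha => rw [map_smul]; exact Submodule.smul_mem _ _ ha
  | mem v hv =>
    obtain ⟨w, hw, rfl⟩ := hv
    exact h w hw

theorem fsProd_dLeft_mem_stable (N N' a k : ℕ) (x : ℕ → R) : fsProd (dLeft R) N' a k x ∈
    stableSubmonoid R {w : Perm ℕ | ∀ i, N ≤ i → w i = i} := by
  suffices h : ∀ j, ∀ w ∈ {w : Perm ℕ | ∀ i, N ≤ i → w i = i}, dLeft R j (basisVec R w) ∈
      Finsupp.supported R R {w : Perm ℕ | ∀ i, N ≤ i → w i = i} from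
    fsProd_mem (d := dLeft R) (stableSubmonoid R _) fun j _ y => fac_mem_stableSubmonoid (h j) y
  intro j w hw
  rw [dLeft_basisVec]
  split_ifs with h
  · refine Finsupp.single_mem_supported R 1 fun i hi => ?_
    have hw' : ∀ i, N ≤ i → w⁻¹ i = i := fun i hi => by
      rw [Perm.inv_eq_iff_eq]; exact (hw i hi).symm
    have hj := lt_of_descent hw' h
    rw [Perm.mul_apply, hw i hi, swap_apply_of_ne_of_ne (by omega) (by omega)]
  · exact Submodule.zero_mem _

end Operators

end Schub

/-! ### Compatible sequences and the Fomin-Stanley formula -/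

namespace Schub

open Equiv

section Biletters

/-- The biletters `(a, i + n - 1), …, (a, i)`. -/
def rowLetters (a : ℕ) : ℕ → ℕ → List (ℕ × ℕ)
  | 0, _ => []
  | n + 1, i => rowLetters a n (i + 1) ++ [(a, i)]

/-- The biletters `(α, ρ)` with `α < k` and `α ≤ ρ < N`, sorted by `biLt`. -/
def biletters (N : ℕ) : ℕ → List (ℕ × ℕ)
  | 0 => []
  | k + 1 => biletters N k ++ rowLetters k (N - k) k

/-- The order of the biletters: `α` increases, and `ρ` decreases for equal `α`. -/
def biLt (p q : ℕ × ℕ) : Prop := p.1 < q.1 ∨ p.1 = q.1 ∧ q.2 < p.2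

theorem mem_rowLetters {a n i : ℕ} {p : ℕ × ℕ} :
    p ∈ rowLetters a n i ↔ p.1 = a ∧ i ≤ p.2 ∧ p.2 < i + n := by
  induction n generalizing i with
  | zero => simp [rowLetters]
  | succ n ih =>
    simp only [rowLetters, List.mem_append, ih, List.mem_singleton, Prod.ext_iff]
    omega

theorem mem_biletters {N k : ℕ} {p : ℕ × ℕ} :
    p ∈ biletters N k ↔ p.1 < k ∧ p.1 ≤ p.2 ∧ p.2 < N := by
  induction k with
  | zero => simp [biletters]
  | succ k ih =>
    simp only [biletters, List.mem_append, ih, mem_rowLetters]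
    omega

theorem rowLetters_pairwise (a n i : ℕ) : (rowLetters a n i).Pairwise biLt := by
  induction n generalizing i with
  | zero => exact List.Pairwise.nil
  | succ n ih =>
    refine List.pairwise_append.2 ⟨ih _, List.pairwise_singleton _ _, fun p hp q hq => ?_⟩
    rw [mem_rowLetters] at hp
    rw [List.mem_singleton.1 hq]
    exact Or.inr ⟨hp.1, by change i < p.2; omega⟩

theorem biletters_pairwise (N k : ℕ) : (biletters N k).Pairwise biLt := by
  induction k with
  | zero => exact List.Pairwise.nil
  | succ k ih =>
    refine List.pairwise_append.2 ⟨ih, rowLetters_pairwise _ _ _, fun p hp q hq => Or.inl ?_⟩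
    rw [mem_biletters] at hp
    rw [mem_rowLetters] at hq
    omega

instance : IsTrans (ℕ × ℕ) biLt := ⟨fun p q r => by unfold biLt; omega⟩

instance : Std.Irrefl biLt := ⟨fun p => by unfold biLt; omega⟩

instance : Std.Antisymm biLt := ⟨fun p q h1 h2 => by unfold biLt at h1 h2; omega⟩

theorem sublist_biletters_iff {N k : ℕ} {s : List (ℕ × ℕ)} :
    s.Sublist (biletters N k) ↔
      s.Pairwise biLt ∧ ∀ p ∈ s, p.1 < k ∧ p.1 ≤ p.2 ∧ p.2 < N := by
  constructor
  · intro h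
    exact ⟨(biletters_pairwise N k).sublist h, fun p hp => mem_biletters.1 (h.subset hp)⟩
  · rintro ⟨h1, h2⟩
    exact List.sublist_of_subperm_of_pairwise
      (h1.nodup.subperm fun p hp => mem_biletters.2 (h2 p hp)) h1 (biletters_pairwise N k)

variable {R E : Type*} [CommRing R] [Ring E] [Algebra R E] (d : ℕ → E)

theorem descProd_eq_prod (a n i : ℕ) (x : ℕ → R) : descProd d n i (x a) =
    ((rowLetters a n i).map fun p => 1 + x p.1 • d p.2).prod := by
  induction n generalizing i with
  | zero => rfl
  | succ n ih => simp [descProd, rowLetters, ih, fac]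

theorem fsProd_eq_prod (N k : ℕ) (x : ℕ → R) : fsProd d N 0 k x =
    ((biletters N k).map fun p => 1 + x p.1 • d p.2).prod := by
  induction k with
  | zero => rfl
  | succ k ih => simp [fsProd, biletters, ih, descProd_eq_prod]

theorem prod_one_add_eq_sum {ι : Type*} (L : List ι) (f : ι → E) :
    (L.map fun p => 1 + f p).prod = (L.sublists'.map fun s => (s.map f).prod).sum := by
  induction L with
  | nil => simp
  | cons a L ih =>
    simp only [List.map_cons, List.prod_cons, ih, List.sublists'_cons, List.map_append,
      List.map_map, List.sum_append, add_mul, one_mul]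
    congr 1
    rw [← List.sum_map_mul_left]
    rfl

theorem prod_smul_eq (s : List (ℕ × ℕ)) (x : ℕ → R) :
    (s.map fun p => x p.1 • d p.2).prod =
      (s.map fun p => x p.1).prod • ((s.map Prod.snd).map d).prod := by
  induction s with
  | nil => simp
  | cons p s ih => simp only [List.map_cons, List.prod_cons, ih, smul_mul_smul_comm]

end Biletters

theorem isReducedWord_nil {w : Perm ℕ} : IsReducedWord w [] ↔ w = 1 := by
  constructor
  · rintro ⟨h, -⟩
    simpa [wordProd] using h.symm
  · rintro rfl
    exact ⟨by simp [wordProd], by simp⟩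

open Classical in
-- The last letter acts first, and each letter must be a descent of what the later letters have
-- left.
theorem coeffOne_word {R : Type*} [CommRing R] (ρ : List ℕ) {w : Perm ℕ} (hw : w ∈ FinPerm) :
    coeffOne R ((ρ.map (dOp R)).prod (basisVec R w)) = if IsReducedWord w ρ then 1 else 0 := by
  induction ρ using List.reverseRecOn generalizing w with
  | nil => simp [isReducedWord_nil, coeffOne_basisVec]
  | append_singleton ρ i ih =>
    rw [List.map_append, List.prod_append, List.map_singleton, List.prod_singleton,
      Module.End.mul_apply, if_congr (isReducedWord_append_iff hw ρ i) rfl rfl]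
    rcases lt_or_gt_adj w i with h | h
    · rw [dOp_of_lt h, map_zero, map_zero, if_neg (by omega)]
    · rw [dOp_of_gt h, ih (mul_swap_mem hw _ _)]
      simp only [h, true_and]

/-- Once equal neighbours are excluded, a compatible sequence can stay constant only where the word
strictly decreases, so compatibility amounts to being sorted by the strict order `biLt`. -/
theorem IsReducedWord.isChain_ne {w : Perm ℕ} (hw : w ∈ FinPerm) {ρ : List ℕ}
    (h : IsReducedWord w ρ) : ρ.IsChain (· ≠ ·) := by
  induction ρ using List.reverseRecOn generalizing w with
  | nil => exact List.isChain_nil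
  | append_singleton ρ i ih =>
    obtain ⟨h1, h2⟩ := (isReducedWord_append_iff hw ρ i).1 h
    refine List.isChain_append.2 ⟨ih (mul_swap_mem hw _ _) h2, List.isChain_singleton _, ?_⟩
    intro j hj i' hi'
    obtain rfl : i = i' := by simpa using hi'
    rintro rfl
    obtain ⟨ρ', rfl⟩ : ∃ ρ', ρ = ρ' ++ [j] := by
      obtain ⟨h3, h4⟩ := List.getLast?_eq_some_iff.1 hj
      exact ⟨h3, h4⟩
    have h3 := ((isReducedWord_append_iff (mul_swap_mem hw _ _) ρ' j).1 h2).1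
    simp at h3
    omega

theorem IsReducedWord.lt {w : Perm ℕ} {N : ℕ} (hN : ∀ i, N ≤ i → w i = i) {ρ : List ℕ}
    (h : IsReducedWord w ρ) : ∀ i ∈ ρ, i + 1 < N := by
  have hw := mem_finPerm_of_fixed hN
  induction ρ using List.reverseRecOn generalizing w with
  | nil => simp
  | append_singleton ρ i ih =>
    obtain ⟨h1, h2⟩ := (isReducedWord_append_iff hw ρ i).1 h
    have hi := lt_of_descent hN h1
    intro j hj
    rcases List.mem_append.1 hj with hj | hj
    · exact ih (fixed_mul_swap hN (by omega) hi) h2 (mul_swap_mem hw _ _) j hj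
    · rw [List.mem_singleton.1 hj]
      exact hi

/-- Reduced compatible pairs are the reduced subwords of the sorted list of biletters. -/
theorem bijOn_compatible {w : Perm ℕ} {N : ℕ} (hN : ∀ i, N ≤ i → w i = i) :
    Set.BijOn (fun s : List (ℕ × ℕ) => (s.map Prod.snd, s.map Prod.fst))
      {s | s.Sublist (biletters N N) ∧ IsReducedWord w (s.map Prod.snd)}
      {p | IsReducedWord w p.1 ∧ IsCompatible p.1 p.2} := by
  refine ⟨?_, ?_, ?_⟩
  · rintro s ⟨h1, h2⟩
    rw [sublist_biletters_iff] at h1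
    refine ⟨h2, by simp, fun j hα hρ => ?_, fun j hα hρ => ?_⟩
    · simp only [List.getElem_map]
      exact (h1.2 _ (List.getElem_mem _)).2.1
    · simp only [List.length_map] at hα
      simp only [List.getElem_map]
      have := List.pairwise_iff_getElem.1 h1.1 j (j + 1) (by omega) hα (by omega)
      unfold biLt at this
      omega
  · intro s _ t _ h
    simp only [Prod.mk.injEq] at h
    rw [← List.zip_unzip s, ← List.zip_unzip t, List.unzip_eq_map, List.unzip_eq_map, h.1, h.2]
  · rintro ⟨ρ, α⟩ ⟨h1, h2, h3, h4⟩
    simp only at h1 h2 h3 h4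
    have hsnd : (List.zip α ρ).map Prod.snd = ρ := List.map_snd_zip (by omega)
    have hfst : (List.zip α ρ).map Prod.fst = α := List.map_fst_zip (by omega)
    refine ⟨List.zip α ρ, ⟨sublist_biletters_iff.2 ⟨?_, ?_⟩, by rwa [hsnd]⟩,
      Prod.ext hsnd hfst⟩
    · rw [← List.isChain_iff_pairwise, List.isChain_iff_getElem]
      intro j hj
      simp only [List.length_zip] at hj
      have hne := List.isChain_iff_getElem.1 (h1.isChain_ne (mem_finPerm_of_fixed hN)) j (by omega)
      have := h4 j (by omega) (by omega)
      simp only [List.getElem_zip, biLt]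
      omega
    · intro p hp
      obtain ⟨j, hj, rfl⟩ := List.getElem_of_mem hp
      simp only [List.length_zip] at hj
      have h5 := h3 j (by omega) (by omega)
      have h6 := h1.lt hN _ (List.getElem_mem (show j < ρ.length by omega))
      simp only [List.getElem_zip]
      omega

open Classical in
theorem schubert_eq_sum {w : Perm ℕ} {N : ℕ} (hN : ∀ i, N ≤ i → w i = i) :
    schubert w = ∑ s ∈ (biletters N N).sublists'.toFinset with IsReducedWord w (s.map Prod.snd),
      (s.map fun p => (MvPolynomial.X p.1 : MvPolynomial ℕ ℤ)).prod := by
  rw [schubert, ← finsum_mem_coe_finset]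
  refine (finsum_mem_eq_of_bijOn
    (fun s : List (ℕ × ℕ) => (s.map Prod.snd, s.map Prod.fst)) ?_ fun s _ => ?_).symm
  · convert bijOn_compatible hN using 1
    ext s
    simp
  · simp [List.map_map, Function.comp_def]

/-- Evaluation of integer polynomials in a commutative ring. -/
noncomputable def evalAt {R : Type*} [CommRing R] (x : ℕ → R) : MvPolynomial ℕ ℤ →+* R :=
  MvPolynomial.eval₂Hom (Int.castRingHom R) x

@[simp] theorem evalAt_X {R : Type*} [CommRing R] (x : ℕ → R) (i : ℕ) :
    evalAt x (MvPolynomial.X i) = x i :=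
  MvPolynomial.eval₂Hom_X' _ _ _

theorem eq_evalAt {R : Type*} [CommRing R] {x : ℕ → R} (φ : MvPolynomial ℕ ℤ →+* R)
    (h : ∀ i, φ (MvPolynomial.X i) = x i) : φ = evalAt x :=
  MvPolynomial.ringHom_ext' (RingHom.ext_int _ _) fun i => by rw [h, evalAt_X]

/-- The Fomin-Stanley formula. -/
theorem evalAt_schubert {R : Type*} [CommRing R] (x : ℕ → R) {w : Perm ℕ} {N : ℕ}
    (hN : ∀ i, N ≤ i → w i = i) : evalAt x (schubert w) =
      coeffOne R (fsProd (dOp R) N 0 N x (basisVec R w)) := by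
  classical
  have hnd : (biletters N N).sublists'.Nodup :=
    List.nodup_sublists'.2 (biletters_pairwise N N).nodup
  rw [schubert_eq_sum hN, fsProd_eq_prod, prod_one_add_eq_sum, ← List.sum_toFinset _ hnd,
    LinearMap.sum_apply, map_sum, map_sum, Finset.sum_filter]
  refine Finset.sum_congr rfl fun s _ => ?_
  rw [prod_smul_eq (dOp R) s x, LinearMap.smul_apply, map_smul, coeffOne_word _ (mem_finPerm_of_fixed hN)]
  split_ifs
  · simp [map_list_prod, List.map_map, Function.comp_def]
  · simp

end Schub

/-! ### Schubert polynomials under evaluation and exchange of variables -/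

namespace Schub

open Equiv

section Action

variable {R : Type*} [CommRing R]

theorem fac_of_lt {i : ℕ} {w : Perm ℕ} (h : w i < w (i + 1)) (x : R) :
    fac (dOp R) i x (basisVec R w) = basisVec R w := by
  simp [fac, dOp_of_lt h]

theorem fac_of_gt {i : ℕ} {w : Perm ℕ} (h : w (i + 1) < w i) (x : R) :
    fac (dOp R) i x (basisVec R w) = basisVec R w + x • basisVec R (w * swap i (i + 1)) := by
  simp only [fac, LinearMap.add_apply, LinearMap.smul_apply, Module.End.one_apply, dOp_of_gt h]

/-- The operators fixing a vector. -/
def fixingSubmonoid (v : PermModule R) : Submonoid (Module.End R (PermModule R)) where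
  carrier := {T | T v = v}
  one_mem' := rfl
  mul_mem' {S T} hS hT := by
    change S (T v) = v
    rw [show T v = v from hT, show S v = v from hS]

theorem descProd_of_incrFrom {a : ℕ} {w : Perm ℕ} (h : IncrFrom a w) (n : ℕ) (x : R) :
    descProd (dOp R) n a x (basisVec R w) = basisVec R w :=
  descProd_mem (d := dOp R) (x := x) (n := n) (fixingSubmonoid (basisVec R w))
    fun j hj => show fac (dOp R) j x (basisVec R w) = _ from fac_of_lt (h j hj) x

theorem ascProd_of_incrFrom {a : ℕ} {w : Perm ℕ} (h : IncrFrom a w) (n : ℕ) (x : R) :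
    ascProd (dOp R) n a x (basisVec R w) = basisVec R w :=
  ascProd_mem (d := dOp R) (x := x) (n := n) (fixingSubmonoid (basisVec R w))
    fun j hj => show fac (dOp R) j x (basisVec R w) = _ from fac_of_lt (h j hj) x

theorem IncrFrom.mono {a b : ℕ} {w : Perm ℕ} (h : IncrFrom a w) (hab : a ≤ b) : IncrFrom b w :=
  fun i hi => h i (hab.trans hi)

/-- The factors for the variables from `k` on act first and involve only operators that annihilate
`w`. In particular the Schubert polynomial depends on the first `k` variables only. -/
theorem fsProd_of_incrFrom {k l N : ℕ} {w : Perm ℕ} (h : IncrFrom k w) (hkl : k ≤ l) (x : ℕ → R) :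
    fsProd (dOp R) N 0 l x (basisVec R w) = fsProd (dOp R) N 0 k x (basisVec R w) := by
  induction l, hkl using Nat.le_induction with
  | base => rfl
  | succ l hl ih =>
    rw [← ih]
    simp only [fsProd, Module.End.mul_apply, zero_add]
    rw [descProd_of_incrFrom (h.mono hl)]

theorem evalAt_schubert_of_incrFrom (x : ℕ → R) {w : Perm ℕ} {k N : ℕ} (h : IncrFrom k w)
    (hk : k ≤ N) (hN : ∀ i, N ≤ i → w i = i) : evalAt x (schubert w) =
      coeffOne R (fsProd (dOp R) N 0 k x (basisVec R w)) := by
  rw [evalAt_schubert x hN, fsProd_of_incrFrom h hk]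

theorem fsProd_congr {E : Type*} [Ring E] [Algebra R E] (d : ℕ → E) {N a k : ℕ} {x y : ℕ → R}
    (h : ∀ i < k, x i = y i) : fsProd d N a k x = fsProd d N a k y := by
  induction k with
  | zero => rfl
  | succ k ih =>
    simp only [fsProd]
    rw [ih fun i hi => h i (by omega), h k (by omega)]

theorem fsProd_eq_of_zero {E : Type*} [Ring E] [Algebra R E] (d : ℕ → E) {N k l : ℕ} {x : ℕ → R}
    (hkl : k ≤ l) (h : ∀ i, k ≤ i → i < l → x i = 0) : fsProd d N 0 l x = fsProd d N 0 k x := by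
  induction l, hkl using Nat.le_induction with
  | base => rfl
  | succ l hl ih =>
    simp [fsProd, ih fun i h1 h2 => h i h1 (by omega), h l hl (by omega)]

end Action

open MvPolynomial

theorem evalAt_X_self (f : MvPolynomial ℕ ℤ) : evalAt X f = f :=
  RingHom.congr_fun (eq_evalAt (RingHom.id _) fun _ => rfl).symm f

theorem evalAt_X_comp (σ : ℕ → ℕ) (f : MvPolynomial ℕ ℤ) : evalAt (X ∘ σ) f = rename σ f :=
  RingHom.congr_fun
    (eq_evalAt (rename σ : MvPolynomial ℕ ℤ →ₐ[ℤ] MvPolynomial ℕ ℤ).toRingHom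
      fun i => by simp).symm f

theorem exists_bounds {w : Perm ℕ} (hw : w ∈ FinPerm) (M : ℕ) :
    ∃ N, M ≤ N ∧ ∀ i, N ≤ i → w i = i := by
  obtain ⟨N, hN⟩ := exists_fixed_bound hw
  exact ⟨max M N, le_max_left _ _, fun i hi => hN i (le_trans (le_max_right _ _) hi)⟩

theorem schubert_one : schubert 1 = 1 := by
  have h := evalAt_schubert_of_incrFrom (X : ℕ → MvPolynomial ℕ ℤ) (w := 1) (k := 0) (N := 0)
    (fun i _ => by simp) le_rfl (fun i _ => rfl)
  rw [evalAt_X_self] at h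
  rw [h]
  simp [fsProd, coeffOne_basisVec]

open Classical in
theorem constantCoeff_schubert {w : Perm ℕ} (hw : w ∈ FinPerm) :
    constantCoeff (schubert w) = if w = 1 then 1 else 0 := by
  obtain ⟨N, hN⟩ := exists_fixed_bound hw
  have h := evalAt_schubert (fun _ => (0 : ℤ)) hN
  rw [fsProd_eq_of_zero _ (Nat.zero_le N) fun i _ _ => rfl] at h
  simp only [fsProd, Module.End.one_apply, coeffOne_basisVec] at h
  rw [← h]
  exact RingHom.congr_fun (eq_evalAt constantCoeff fun i => by simp) _

/-- In `fsProd_sub_swap` the generator stands at the right end of the product, so it acts on `w`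
first and removes the descent. -/
theorem schubert_sub_rename {w : Perm ℕ} (hw : w ∈ FinPerm) (i : ℕ) :
    schubert w - rename (swap i (i + 1)) (schubert w) = (X i - X (i + 1)) *
      if w (i + 1) < w i then schubert (w * swap i (i + 1)) else 0 := by
  obtain ⟨N, hiN, hN⟩ := exists_bounds hw (i + 2)
  have h1 := evalAt_schubert (X : ℕ → MvPolynomial ℕ ℤ) hN
  have h2 := evalAt_schubert (X ∘ swap i (i + 1) : ℕ → MvPolynomial ℕ ℤ) hN
  rw [evalAt_X_self] at h1
  rw [← evalAt_X_comp, h2, h1, ← map_sub, ← LinearMap.sub_apply,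
    (isNilCoxeter_dOp (R := MvPolynomial ℕ ℤ)).fsProd_sub_swap _ _ hiN le_rfl, LinearMap.smul_apply, map_smul, smul_eq_mul,
    Module.End.mul_apply, dOp_basisVec]
  split_ifs
  · rw [← evalAt_schubert X (fixed_mul_swap hN (by omega) (by omega)), evalAt_X_self]
  · simp

/-! ### Divided differences and dual functionals -/

section DividedDifference

variable {R : Type*} [CommRing R]

theorem dvd_sub_rename (i : ℕ) (f : MvPolynomial ℕ R) :
    (X i - X (i + 1) : MvPolynomial ℕ R) ∣ f - rename (swap i (i + 1)) f := by
  induction f using MvPolynomial.induction_on with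
  | C a => simp
  | add p q hp hq =>
    rw [map_add, add_sub_add_comm]
    exact dvd_add hp hq
  | mul_X p n hp =>
    have h : (X i - X (i + 1) : MvPolynomial ℕ R) ∣ X n - X (swap i (i + 1) n) := by
      rw [swap_apply_def]
      split_ifs with h1 h2
      · rw [h1]
      · rw [h2, ← neg_sub (X i)]
        exact (dvd_refl _).neg_right
      · simp
    rw [map_mul, rename_X, show p * X n - rename (swap i (i + 1)) p * X (swap i (i + 1) n) =
      (p - rename (swap i (i + 1)) p) * X n +
        rename (swap i (i + 1)) p * (X n - X (swap i (i + 1) n)) by ring]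
    exact dvd_add (hp.mul_right _) (h.mul_left _)

theorem X_sub_X_ne_zero [Nontrivial R] (i : ℕ) : (X i - X (i + 1) : MvPolynomial ℕ R) ≠ 0 := by
  rw [sub_ne_zero]
  intro h
  have := X_injective h
  omega

variable (R) [IsDomain R]

/-- The divided difference operator. -/
noncomputable def divDiff (i : ℕ) : MvPolynomial ℕ R →ₗ[R] MvPolynomial ℕ R where
  toFun f := (dvd_sub_rename i f).choose
  map_add' f g := by
    apply mul_left_cancel₀ (X_sub_X_ne_zero (R := R) i)
    rw [mul_add, ← (dvd_sub_rename i f).choose_spec, ← (dvd_sub_rename i g).choose_spec,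
      ← (dvd_sub_rename i (f + g)).choose_spec, map_add]
    ring
  map_smul' c f := by
    apply mul_left_cancel₀ (X_sub_X_ne_zero (R := R) i)
    rw [RingHom.id_apply, mul_smul_comm, ← (dvd_sub_rename i f).choose_spec,
      ← (dvd_sub_rename i (c • f)).choose_spec, map_smul, smul_sub]

variable {R}

theorem mul_divDiff (i : ℕ) (f : MvPolynomial ℕ R) :
    (X i - X (i + 1)) * divDiff R i f = f - rename (swap i (i + 1)) f :=
  (dvd_sub_rename i f).choose_spec.symm

theorem divDiff_eq {i : ℕ} {f g : MvPolynomial ℕ R}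
    (h : f - rename (swap i (i + 1)) f = (X i - X (i + 1)) * g) : divDiff R i f = g :=
  mul_left_cancel₀ (X_sub_X_ne_zero (R := R) i) (by rw [mul_divDiff, h])

theorem divDiff_X_mul (i r : ℕ) (f : MvPolynomial ℕ R) : divDiff R i (X r * f) =
    X (swap i (i + 1) r) * divDiff R i f +
      ((if r = i then 1 else 0) - if r = i + 1 then 1 else 0) * f := by
  apply divDiff_eq
  have h : (X r - X (swap i (i + 1) r) : MvPolynomial ℕ R) =
      (X i - X (i + 1)) * ((if r = i then 1 else 0) - if r = i + 1 then 1 else 0) := by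
    rw [swap_apply_def]
    split_ifs with h1 h2 h2
    · omega
    · rw [h1]; ring
    · rw [h2]; ring
    · ring
  rw [map_mul, rename_X, mul_add, ← mul_assoc, ← mul_assoc, ← h, mul_right_comm, mul_divDiff]
  ring

theorem map_schubert_divDiff {w : Perm ℕ} (hw : w ∈ FinPerm) (i : ℕ) :
    divDiff R i (map (Int.castRingHom R) (schubert w)) =
      if w (i + 1) < w i then map (Int.castRingHom R) (schubert (w * swap i (i + 1))) else 0 := by
  apply divDiff_eq
  have h := congrArg (map (Int.castRingHom R)) (schubert_sub_rename hw i)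
  rw [map_sub, map_rename] at h
  rw [h, map_mul, map_sub, map_X, map_X]
  split_ifs <;> simp

theorem schubert_divDiff {w : Perm ℕ} (hw : w ∈ FinPerm) (i : ℕ) :
    divDiff ℤ i (schubert w) = if w (i + 1) < w i then schubert (w * swap i (i + 1)) else 0 :=
  divDiff_eq (schubert_sub_rename hw i)

open Classical in
/-- The coefficient functionals dual to the Schubert polynomials. -/
theorem exists_dual_functional (R : Type*) [CommRing R] [IsDomain R] {v : Perm ℕ}
    (hv : v ∈ FinPerm) : ∃ κ : MvPolynomial ℕ R →ₗ[R] R, ∀ w ∈ FinPerm,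
      κ (map (Int.castRingHom R) (schubert w)) = if w = v then 1 else 0 := by
  refine finPerm_induction ?_ ?_ v hv
  · refine ⟨lcoeff R 0, fun w hw => ?_⟩
    have h := constantCoeff_schubert hw
    rw [constantCoeff_eq] at h
    rw [lcoeff_apply, coeff_map, h]
    split_ifs <;> simp
  · rintro v hv i hi ⟨κ, hκ⟩
    -- The functional is the constant term taken after the divided differences along a reduced word
    -- of `v`.
    refine ⟨κ ∘ₗ divDiff R i, fun w hw => ?_⟩
    rw [LinearMap.comp_apply, map_schubert_divDiff hw]
    split_ifs with h1 h2 h2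
    · rw [hκ _ (mul_swap_mem hw _ _), if_pos (by rw [h2])]
    · rw [hκ _ (mul_swap_mem hw _ _), if_neg (fun h => h2 (mul_right_cancel h))]
    · subst h2
      omega
    · rw [map_zero]

/-- A polynomial in infinitely many variables that is symmetric is constant. -/
theorem eq_C_of_rename_eq {f : MvPolynomial ℕ ℤ}
    (h : ∀ i, rename (swap i (i + 1)) f = f) : f = C (constantCoeff f) := by
  -- Invariance passes an occurring variable on to the next one, but only finitely many occur.
  have hstep : ∀ i, i ∈ f.vars → i + 1 ∈ f.vars := by
    intro i hi
    rw [← h i] at hi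
    obtain ⟨j, hj, hji⟩ := mem_vars_rename _ _ hi
    rw [swap_apply_eq_iff, swap_apply_left] at hji
    exact hji ▸ hj
  have hvars : f.vars = ∅ := by
    rw [Finset.eq_empty_iff_forall_notMem]
    intro i hi
    have hall : ∀ n, i + n ∈ f.vars := fun n => by
      induction n with
      | zero => exact hi
      | succ n ih => exact hstep _ ih
    obtain ⟨B, hB⟩ := f.vars.bddAbove
    have := hB (hall (B + 1))
    omega
  rw [constantCoeff_eq]
  exact vars_eq_empty_iff_eq_C.1 hvars

end DividedDifference

end Schub

/-! ### Monk's formula -/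

namespace Schub

open Equiv MvPolynomial

/-- Exchanging adjacent positions preserves covers that create a descent there. -/
theorem isCover_descent_iff {w : Perm ℕ} {i r s : ℕ} (h : ¬ (r = i ∧ s = i + 1))
    (h' : ¬ (s = i ∧ r = i + 1)) :
    (IsCover w r s ∧ (w * swap r s) (i + 1) < (w * swap r s) i) ↔
      (w (i + 1) < w i ∧
        IsCover (w * swap i (i + 1)) (swap i (i + 1) r) (swap i (i + 1) s)) := by
  have key : IsCover (w * swap i (i + 1)) (swap i (i + 1) r) (swap i (i + 1) s) ↔
      swap i (i + 1) r < swap i (i + 1) s ∧ w r < w s ∧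
        ∀ c, swap i (i + 1) r < swap i (i + 1) c → swap i (i + 1) c < swap i (i + 1) s →
          w c < w r ∨ w s < w c := by
    unfold IsCover
    simp only [Perm.mul_apply, swap_apply_self]
    refine and_congr_right fun _ => and_congr_right fun _ => ⟨fun hc c h1 h2 => ?_,
      fun hc c h1 h2 => ?_⟩
    · simpa using hc _ h1 h2
    · exact hc (swap i (i + 1) c) (by simpa using h1) (by simpa using h2)
  have hw : ∀ a b, w a = w b → a = b := fun a b => fun hab => w.injective hab
  rw [key]
  simp only [IsCover, Perm.mul_apply, swap_apply_def]
  constructor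
  · rintro ⟨⟨h1, h2, h3⟩, h4⟩
    have h5 := h3 i
    have h6 := h3 (i + 1)
    grind
  · rintro ⟨h1, h2, h3, h4⟩
    have h5 := h4 i
    have h6 := h4 (i + 1)
    clear key
    refine ⟨⟨?_, h3, fun c hc1 hc2 => ?_⟩, ?_⟩
    · clear h4 h5 h6
      split_ifs at h2 <;> omega
    · have h7 := h4 c
      clear h4 h5 h6
      grind
    · clear h4
      grind

theorem mul_swap_conj (w : Perm ℕ) (i r s : ℕ) : w * swap r s * swap i (i + 1) =
    w * swap i (i + 1) * swap (swap i (i + 1) r) (swap i (i + 1) s) := by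
  rw [mul_assoc, mul_assoc, mul_swap_eq_swap_mul (swap i (i + 1))]
  simp

open Classical in
/-- The signed contribution of the exchange of `r` and `s` to Monk's formula for `x_r`. -/
noncomputable def monkTerm (w : Perm ℕ) (r s : ℕ) : MvPolynomial ℕ ℤ :=
  if IsCover w r s then schubert (w * swap r s)
  else if IsCover w s r then -schubert (w * swap s r) else 0

theorem IsCover.asymm {w : Perm ℕ} {r s : ℕ} (h : IsCover w r s) : ¬ IsCover w s r :=
  fun h' => by have := h.1; have := h'.1; omega

theorem monkTerm_of_isCover {w : Perm ℕ} {r s : ℕ} (h : IsCover w r s) :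
    monkTerm w r s = schubert (w * swap r s) := if_pos h

theorem monkTerm_of_isCover_symm {w : Perm ℕ} {r s : ℕ} (h : IsCover w s r) :
    monkTerm w r s = -schubert (w * swap s r) := by
  rw [monkTerm, if_neg h.asymm, if_pos h]

theorem monkTerm_eq_zero {w : Perm ℕ} {r s : ℕ} (h1 : ¬ IsCover w r s) (h2 : ¬ IsCover w s r) :
    monkTerm w r s = 0 := by
  rw [monkTerm, if_neg h1, if_neg h2]

theorem monkTerm_symm (w : Perm ℕ) (r s : ℕ) : monkTerm w s r = -monkTerm w r s := by
  by_cases h1 : IsCover w r s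
  · rw [monkTerm_of_isCover h1, monkTerm_of_isCover_symm h1]
  · by_cases h2 : IsCover w s r
    · rw [monkTerm_of_isCover h2, monkTerm_of_isCover_symm h2, neg_neg]
    · rw [monkTerm_eq_zero h1 h2, monkTerm_eq_zero h2 h1, neg_zero]

theorem IsCover.mul_swap_ne_one {w : Perm ℕ} {a b : ℕ} (h : IsCover w a b) :
    w * swap a b ≠ 1 := by
  intro h'
  rw [mul_eq_one_iff_eq_inv, swap_inv] at h'
  have h1 := h.1
  have h2 := h.2.1
  rw [h', swap_apply_left, swap_apply_right] at h2
  omega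

theorem constantCoeff_monkTerm {w : Perm ℕ} (hw : w ∈ FinPerm) (r s : ℕ) :
    constantCoeff (monkTerm w r s) = 0 := by
  classical
  unfold monkTerm
  split_ifs with h1 h2
  · rw [constantCoeff_schubert (mul_swap_mem hw _ _), if_neg h1.mul_swap_ne_one]
  · rw [map_neg, constantCoeff_schubert (mul_swap_mem hw _ _), if_neg h2.mul_swap_ne_one, neg_zero]
  · exact map_zero _

/-- If `s` were too large, the position `N` or `r + 1` would lie between `r` and `s` and carry an
intermediate value. This makes the sum in Monk's formula finite and independent of its bound. -/
theorem lt_of_isCover {w : Perm ℕ} {N B : ℕ} (hN : ∀ i, N ≤ i → w i = i) (hB : N < B)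
    {r s : ℕ} (hr : r + 1 < B) (h : IsCover w r s) : s < B := by
  by_contra hs
  obtain ⟨h1, h2, h3⟩ := h
  have ws := hN s (by omega)
  by_cases hrN : r < N
  · have h4 := lt_of_fixed hN hrN
    have h5 := hN N le_rfl
    have := h3 N hrN (by omega)
    omega
  · have h4 := hN r (by omega)
    have h5 := hN (r + 1) (by omega)
    have := h3 (r + 1) (by omega) (by omega)
    omega

theorem sum_monkTerm_eq {w : Perm ℕ} {N B B' : ℕ} (hN : ∀ i, N ≤ i → w i = i) (hB : N < B)
    (hBB' : B ≤ B') {r : ℕ} (hr : r + 1 < B) :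
    ∑ s ∈ Finset.range B, monkTerm w r s = ∑ s ∈ Finset.range B', monkTerm w r s := by
  refine Finset.sum_subset (Finset.range_subset_range.2 hBB') fun s _ hs => ?_
  rw [Finset.mem_range] at hs
  refine monkTerm_eq_zero (fun h => hs (lt_of_isCover hN hB hr h)) fun h => ?_
  have := h.1
  omega

/-- By `isCover_descent_iff`, the terms surviving the divided difference match the covers of `w *
swap i (i + 1)`. The excluded exchange of `i` and `i + 1` does not follow this pattern. -/
theorem divDiff_monkTerm {w : Perm ℕ} (hw : w ∈ FinPerm) {i r s : ℕ}
    (h1 : ¬ (r = i ∧ s = i + 1)) (h2 : ¬ (s = i ∧ r = i + 1)) :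
    divDiff ℤ i (monkTerm w r s) = if w (i + 1) < w i then
      monkTerm (w * swap i (i + 1)) (swap i (i + 1) r) (swap i (i + 1) s) else 0 := by
  have aux : ∀ r s, ¬ (r = i ∧ s = i + 1) → ¬ (s = i ∧ r = i + 1) → IsCover w r s →
      divDiff ℤ i (schubert (w * swap r s)) = if w (i + 1) < w i then
        monkTerm (w * swap i (i + 1)) (swap i (i + 1) r) (swap i (i + 1) s) else 0 := by
    intro r s h1 h2 hc
    have hiff := isCover_descent_iff (w := w) h1 h2
    rw [schubert_divDiff (mul_swap_mem hw _ _)]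
    by_cases hd : (w * swap r s) (i + 1) < (w * swap r s) i
    · obtain ⟨h3, h4⟩ := hiff.1 ⟨hc, hd⟩
      rw [if_pos hd, if_pos h3, monkTerm_of_isCover h4, mul_swap_conj]
    · rw [if_neg hd]
      split_ifs with h3
      · rw [monkTerm_eq_zero]
        · exact fun h4 => hd (hiff.2 ⟨h3, h4⟩).2
        · intro h4
          have h5 := h4.1
          have h6 := swap_adj_lt hc.1 h1
          omega
      · rfl
  by_cases hc : IsCover w r s
  · rw [monkTerm_of_isCover hc, aux r s h1 h2 hc]
  · by_cases hc' : IsCover w s r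
    · rw [monkTerm_of_isCover_symm hc', map_neg, aux s r h2 h1 hc']
      split_ifs
      · rw [monkTerm_symm, neg_neg]
      · simp
    · rw [monkTerm_eq_zero hc hc', map_zero]
      split_ifs with h3
      · rw [monkTerm_eq_zero]
        · exact fun h4 => hc ((isCover_descent_iff h1 h2).2 ⟨h3, h4⟩).1
        · exact fun h4 => hc' ((isCover_descent_iff h2 h1).2 ⟨h3, h4⟩).1
      · rfl

/-- The exceptional exchange supplies the extra Schubert polynomial demanded by the Leibniz rule
`divDiff_X_mul`. -/
theorem divDiff_monkTerm_adj {w : Perm ℕ} (hw : w ∈ FinPerm) (i : ℕ) :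
    divDiff ℤ i (monkTerm w i (i + 1)) = schubert w + if w (i + 1) < w i then
      monkTerm (w * swap i (i + 1)) (i + 1) i else 0 := by
  rcases lt_or_gt_adj w i with h | h
  · rw [monkTerm_of_isCover ((isCover_adj_iff w i).2 h), schubert_divDiff (mul_swap_mem hw _ _),
      mul_swap_swap, if_pos (by simpa using h), if_neg (by omega), add_zero]
  · rw [monkTerm_eq_zero (fun h' => by have := h'.2.1; omega) (fun h' => by have := h'.1; omega),
      if_pos h, monkTerm_of_isCover_symm ((isCover_adj_iff _ i).2 (by simpa using h)),
      mul_swap_swap, map_zero, add_neg_cancel]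

theorem divDiff_sum_monkTerm {w : Perm ℕ} (hw : w ∈ FinPerm) {i r B : ℕ} (hi : i + 1 < B) :
    divDiff ℤ i (∑ s ∈ Finset.range B, monkTerm w r s) =
      (if w (i + 1) < w i then
        ∑ s ∈ Finset.range B, monkTerm (w * swap i (i + 1)) (swap i (i + 1) r) s else 0) +
      ((if r = i then 1 else 0) - if r = i + 1 then 1 else 0) * schubert w := by
  set E : ℕ → MvPolynomial ℕ ℤ := fun s => if w (i + 1) < w i then
    monkTerm (w * swap i (i + 1)) (swap i (i + 1) r) (swap i (i + 1) s) else 0 with hE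
  have hsum : (if w (i + 1) < w i then
      ∑ s ∈ Finset.range B, monkTerm (w * swap i (i + 1)) (swap i (i + 1) r) s else 0) =
      ∑ s ∈ Finset.range B, E s := by
    simp only [hE]
    split_ifs
    · refine Finset.sum_equiv (swap i (i + 1)) (fun s => ?_) fun s _ => ?_
      · simp only [Finset.mem_range, swap_apply_def]
        split_ifs <;> omega
      · rw [swap_apply_self]
    · simp
  have hdiff : ∑ s ∈ Finset.range B, (divDiff ℤ i (monkTerm w r s) - E s) =
      ((if r = i then 1 else 0) - if r = i + 1 then 1 else 0) * schubert w := by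
    by_cases h1 : r = i
    · subst h1
      rw [Finset.sum_eq_single (r + 1)]
      · rw [divDiff_monkTerm_adj hw]
        simp [hE]
      · intro s _ hs
        rw [divDiff_monkTerm hw (by omega) (by omega), sub_self]
      · intro h
        exact absurd (Finset.mem_range.2 hi) h
    · by_cases h2 : r = i + 1
      · subst h2
        rw [Finset.sum_eq_single i]
        · rw [monkTerm_symm, map_neg, divDiff_monkTerm_adj hw]
          simp only [hE, swap_apply_right, swap_apply_left, monkTerm_symm _ (i + 1) i]
          split_ifs <;> first | omega | ring
        · intro s _ hs
          rw [divDiff_monkTerm hw (by omega) (by omega), sub_self]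
        · intro h
          exact absurd (Finset.mem_range.2 (by omega)) h
      · rw [if_neg h1, if_neg h2, sub_self, zero_mul]
        refine Finset.sum_eq_zero fun s _ => ?_
        rw [divDiff_monkTerm hw (by omega) (by omega), sub_self]
  rw [Finset.sum_sub_distrib, sub_eq_iff_eq_add] at hdiff
  rw [map_sum, hdiff, hsum, add_comm]

/-- Monk's formula for a single variable. -/
theorem monk {w : Perm ℕ} {N B : ℕ} (hN : ∀ i, N ≤ i → w i = i) (hB : N < B)
    {r : ℕ} (hr : r + 1 < B) :
    X r * schubert w = ∑ s ∈ Finset.range B, monkTerm w r s := by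
  induction hn : len w using Nat.strong_induction_on generalizing w N B r with
  | _ n ih =>
    subst hn
    have hw := mem_finPerm_of_fixed hN
    rw [← sub_eq_zero]
    set f := X r * schubert w - ∑ s ∈ Finset.range B, monkTerm w r s with hf
    -- By induction on the length all divided differences of `f` vanish. Hence `f` is symmetric in
    -- infinitely many variables, so constant, and its constant term is zero.
    have hsym : ∀ i, rename (swap i (i + 1)) f = f := by
      intro i
      suffices h : divDiff ℤ i f = 0 by
        have := mul_divDiff i f
        rw [h, mul_zero] at this
        exact (sub_eq_zero.1 this.symm).symm
      -- The induction hypothesis is used for the variable index `swap i (i + 1) r`, which may be `i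
      -- + 1` and must still be less than `B' - 1`.
      set B' := max B (i + 3) with hB'
      have hBB' : B ≤ B' := le_max_left _ _
      have hiB : i + 3 ≤ B' := le_max_right _ _
      rw [hf, sum_monkTerm_eq hN hB hBB' hr, map_sub, divDiff_sum_monkTerm hw (by omega),
        divDiff_X_mul, schubert_divDiff hw, add_sub_add_right_eq_sub]
      split_ifs with hd
      · have hi := lt_of_descent hN hd
        rw [ih (B := B') _ (by have := len_mul_swap_of_gt hw hd; omega)
          (fixed_mul_swap hN (by omega) hi) (by omega) ?_ rfl, sub_self]
        rw [swap_apply_def]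
        split_ifs <;> omega
      · simp
    have h0 : constantCoeff f = 0 := by
      rw [hf, map_sub, map_mul, constantCoeff_X, zero_mul, map_sum,
        Finset.sum_eq_zero fun s _ => constantCoeff_monkTerm hw r s, sub_zero]
    rw [eq_C_of_rename_eq hsym, h0, C_0]

open Classical in
/-- The covers of `w` that exchange a position `< k` with a position `≥ k`. -/
noncomputable def coverSet (k B : ℕ) (w : Perm ℕ) : Finset (ℕ × ℕ) :=
  {p ∈ Finset.range k ×ˢ Finset.Ico k B | IsCover w p.1 p.2}

/-- Monk's formula. -/
theorem monk_sum {w : Perm ℕ} {k N B : ℕ} (hN : ∀ i, N ≤ i → w i = i) (hB : N < B)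
    (hk : k < B) : (∑ r ∈ Finset.range k, X r) * schubert w =
      ∑ p ∈ coverSet k B w, schubert (w * swap p.1 p.2) := by
  -- Exchanges within the first `k` positions cancel by antisymmetry.
  have h1 : ∑ r ∈ Finset.range k, ∑ s ∈ Finset.range k, monkTerm w r s = 0 := by
    rw [← self_eq_neg]
    conv_rhs => rw [Finset.sum_comm]
    rw [← Finset.sum_neg_distrib]
    refine Finset.sum_congr rfl fun r _ => ?_
    rw [← Finset.sum_neg_distrib]
    exact Finset.sum_congr rfl fun s _ => monkTerm_symm _ _ _
  rw [Finset.sum_mul, coverSet, Finset.sum_filter, Finset.sum_product]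
  rw [Finset.sum_congr rfl fun r hr => (monk hN hB (by rw [Finset.mem_range] at hr; omega)).trans
    (Finset.sum_range_add_sum_Ico _ hk.le).symm, Finset.sum_add_distrib, h1, zero_add]
  refine Finset.sum_congr rfl fun r hr => Finset.sum_congr rfl fun s hs => ?_
  rw [Finset.mem_range] at hr
  rw [Finset.mem_Ico] at hs
  split_ifs with h
  · exact monkTerm_of_isCover h
  · exact monkTerm_eq_zero h fun h' => by have := h'.1; omega

/-! ### Truncation of variables by transition -/

section Transition

/-- Setting all variables of index `≥ m` to zero. -/
noncomputable def trunc (m : ℕ) : MvPolynomial ℕ ℤ →+* MvPolynomial ℕ ℤ :=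
  evalAt fun j => if j < m then X j else 0

theorem trunc_schubert {m : ℕ} {w : Perm ℕ} (hw : w ∈ FinPerm) (h : IncrFrom m w) :
    trunc m (schubert w) = schubert w := by
  obtain ⟨N, hm, hN⟩ := exists_bounds hw m
  conv_rhs => rw [← evalAt_X_self (schubert w)]
  have hc : fsProd (dOp (MvPolynomial ℕ ℤ)) N 0 m (fun j => if j < m then X j else 0) =
      fsProd (dOp (MvPolynomial ℕ ℤ)) N 0 m X := fsProd_congr (R := MvPolynomial ℕ ℤ) (dOp (MvPolynomial ℕ ℤ)) fun i hi => if_pos hi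
  rw [trunc, evalAt_schubert_of_incrFrom _ h hm hN, evalAt_schubert_of_incrFrom _ h hm hN, hc]

/-- Transition: truncated Schubert polynomials are sums of Schubert polynomials. -/
theorem trunc_schubert_mem {m : ℕ} {w : Perm ℕ} (hw : w ∈ FinPerm) :
    trunc m (schubert w) ∈
      AddSubmonoid.closure (schubert '' {v | v ∈ FinPerm ∧ IncrFrom m v}) := by
  suffices h : ∀ r, m ≤ r → ∀ w ∈ FinPerm, IncrFrom r w → trunc m (schubert w) ∈
      AddSubmonoid.closure (schubert '' {v | v ∈ FinPerm ∧ IncrFrom m v}) by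
    obtain ⟨N, hm, hN⟩ := exists_bounds hw m
    exact h N hm w hw fun i hi => by rw [hN i hi, hN (i + 1) (by omega)]; omega
  intro r hr
  induction r, hr using Nat.le_induction with
  | base =>
    intro w hw h
    rw [trunc_schubert hw h]
    exact AddSubmonoid.subset_closure ⟨w, ⟨hw, h⟩, rfl⟩
  | succ r hr ih =>
    intro w hw h
    -- The outer induction lowers the bound on the last descent; the inner one lowers the value at
    -- that position.
    induction hn : w r using Nat.strong_induction_on generalizing w with
    | _ n ihn =>
      subst hn
      rcases lt_or_gt_adj w r with hlt | hgt
      · refine ih w hw fun i hi => ?_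
        rcases Nat.eq_or_lt_of_le hi with rfl | hi
        · exact hlt
        · exact h i hi
      obtain ⟨N, -, hN⟩ := exists_bounds hw 0
      have hrN := lt_of_descent hN hgt
      have hex : ∃ c, r < c ∧ w r < w c :=
        ⟨N, by omega, by rw [hN N le_rfl]; exact lt_of_fixed hN (by omega)⟩
      -- As `w` increases after `r`, the last position with a value below `w r` is the one just
      -- before the first larger value.
      obtain ⟨s, hrs, hsr, hs⟩ : ∃ s, r < s ∧ w s < w r ∧ ∀ c, s < c → w r < w c := by
        classical
        have h1 := Nat.find_spec hex
        have h2 := fun c => Nat.find_min hex (m := c)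
        set c₀ := Nat.find hex
        have h3 : c₀ ≠ r + 1 := fun h' => by rw [h'] at h1; omega
        have h4 := h2 (c₀ - 1) (by omega)
        have h5 : w (c₀ - 1) ≠ w r := fun h' => by have := w.injective h'; omega
        refine ⟨c₀ - 1, by omega, by omega, fun c hc => ?_⟩
        rcases Nat.eq_or_lt_of_le (show c₀ ≤ c by omega) with rfl | hc'
        · exact h1.2
        · exact h1.2.trans (h.lt (by omega) hc')
      have hsN : s < N := by
        by_contra hle
        have h1 := hN s (by omega)
        have h2 := lt_of_fixed hN (show r < N by omega)
        omega
      set v := w * swap r s with hv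
      have hvr : v r = w s := by simp [v]
      have hvs : v s = w r := by simp [v]
      have hvc : ∀ c, c ≠ r → c ≠ s → v c = w c := fun c h1 h2 => by
        simp [v, swap_apply_of_ne_of_ne h1 h2]
      have hvw : v * swap r s = w := mul_swap_swap w r s
      have hvmem : v ∈ FinPerm := mul_swap_mem hw _ _
      have hvN : ∀ i, N ≤ i → v i = i := fixed_mul_swap hN (by omega) hsN
      have hcov : IsCover v r s := by
        refine ⟨hrs, by omega, fun c h1 h2 => Or.inl ?_⟩
        rw [hvr, hvc c (by omega) (by omega)]
        exact h.lt (by omega) h2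
      -- Monk's formula for `X r * schubert v` contains `schubert w` as the term of `s`. Truncation
      -- kills `X r` because `m ≤ r`, so the truncation of `schubert w` is the negated sum of the
      -- others; the terms with `q < r` carry a minus sign there.
      have hmonk := congrArg (trunc m) (monk hvN (B := N + 1) (by omega) (r := r) (by omega))
      rw [map_mul, trunc, evalAt_X, if_neg (by omega), zero_mul, ← trunc,
        ← Finset.add_sum_erase _ _ (Finset.mem_range.2 (show s < N + 1 by omega)),
        monkTerm_of_isCover hcov, hvw, map_add, eq_comm, add_eq_zero_iff_eq_neg, map_sum,
        ← Finset.sum_neg_distrib] at hmonk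
      rw [hmonk]
      refine AddSubmonoid.sum_mem _ fun q hq => ?_
      obtain ⟨hqs, -⟩ := Finset.mem_erase.1 hq
      rw [← map_neg, ← monkTerm_symm]
      by_cases hc1 : IsCover v q r
      · rw [monkTerm_of_isCover hc1]
        have hqr := hc1.1
        have e1 : ∀ c, r < c → (v * swap q r) c = v c := fun c hc => by
          rw [Perm.mul_apply, swap_apply_of_ne_of_ne (by omega) (by omega)]
        have e2 : (v * swap q r) r = v q := by simp
        refine ihn _ ?_ _ (mul_swap_mem hvmem _ _) (fun i hi => ?_) rfl
        · rw [e2]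
          have := hc1.2.1
          omega
        · rw [e1 i (by omega), e1 (i + 1) (by omega)]
          have h0 := h i hi
          by_cases h1 : i = s
          · rw [h1, hvs, hvc _ (by omega) (by omega)]
            exact hs _ (by omega)
          · by_cases h2 : i + 1 = s
            · rw [h2, hvs, hvc _ (by omega) h1]
              rw [h2] at h0
              omega
            · rw [hvc _ (by omega) h1, hvc _ (by omega) h2]
              exact h0
      · by_cases hc2 : IsCover v r q
        -- The choice of `s` leaves no other cover of `v` to the right of `r`, so no term of the
        -- wrong sign occurs.
        · exfalso
          obtain ⟨h1, h2, h3⟩ := hc2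
          rw [hvr, hvc q (by omega) hqs] at h2
          rcases lt_or_gt_of_ne hqs with h4 | h4
          · have := h.lt (by omega) h4
            omega
          · have h5 := h3 s hrs h4
            rw [hvs, hvr, hvc q (by omega) hqs] at h5
            have := hs q h4
            omega
        · rw [monkTerm_eq_zero hc1 hc2, map_zero]
          exact zero_mem _

end Transition

end Schub

/-! ### The product with a rectangle -/

namespace Schub

open Equiv MvPolynomial

section Rectangle

/-- The permutation `1^m × u`. -/
def shiftPerm (m : ℕ) (u : Perm ℕ) : Perm ℕ where
  toFun i := if i < m then i else m + u (i - m)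
  invFun i := if i < m then i else m + u.symm (i - m)
  left_inv i := by
    by_cases h : i < m
    · simp [h]
    · simp [h]
      omega
  right_inv i := by
    by_cases h : i < m
    · simp [h]
    · simp [h]
      omega

theorem shiftPerm_apply (m : ℕ) (u : Perm ℕ) (i : ℕ) :
    shiftPerm m u i = if i < m then i else m + u (i - m) := rfl

/-- The permutation exchanging the blocks `[j, j + k)` and `[j + k, m + k)`. -/
def blockPerm (m k j : ℕ) : Perm ℕ where
  -- For `j > m` the blocks make no sense, and the identity is taken.
  toFun i := if i < j ∨ m < j then i else if i < j + k then i + (m - j) else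
    if i < m + k then i - k else i
  invFun i := if i < j ∨ m < j then i else if i < m then i + k else
    if i < m + k then i - (m - j) else i
  left_inv i := by
    dsimp only
    split_ifs <;> omega
  right_inv i := by
    dsimp only
    split_ifs <;> omega

theorem blockPerm_apply {m k j : ℕ} (h : j ≤ m) (i : ℕ) : blockPerm m k j i =
    if i < j then i else if i < j + k then i + (m - j) else if i < m + k then i - k else i := by
  change (if i < j ∨ m < j then i else _) = _
  split_ifs <;> omega

theorem blockPerm_inv_apply (m k i : ℕ) : (blockPerm m k 0)⁻¹ i =
    if i < m then i + k else if i < m + k then i - m else i := by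
  change (if i < 0 ∨ m < 0 then i else if i < m then i + k else
    if i < m + k then i - (m - 0) else i) = _
  simp

/-- The cycle moving the entry in position `j + k` to position `j`. -/
def cyc (j : ℕ) : ℕ → Perm ℕ
  | 0 => 1
  | k + 1 => swap (j + k) (j + k + 1) * cyc j k

theorem cyc_apply (j k i : ℕ) : cyc j k i =
    if i = j then j + k else if j < i ∧ i ≤ j + k then i - 1 else i := by
  induction k with
  | zero =>
    simp only [cyc, Perm.one_apply]
    split_ifs <;> omega
  | succ k ih =>
    simp only [cyc, Perm.mul_apply, ih]
    simp only [swap_apply_def]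
    split_ifs <;> omega

theorem blockPerm_mul_cyc {m k j : ℕ} (h : j < m) :
    blockPerm m k j * cyc j k = blockPerm m k (j + 1) := by
  ext i
  rw [Perm.mul_apply, cyc_apply, blockPerm_apply h.le, blockPerm_apply h]
  split_ifs <;> omega

theorem blockPerm_self (m k : ℕ) : blockPerm m k m = 1 := by
  ext i
  rw [blockPerm_apply le_rfl, Perm.one_apply]
  split_ifs <;> omega

theorem shiftPerm_one (m : ℕ) : shiftPerm m 1 = 1 := by
  ext i
  rw [shiftPerm_apply, Perm.one_apply, Perm.one_apply]
  split_ifs <;> omega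

theorem shiftPerm_eq_one_iff {m : ℕ} {u : Perm ℕ} : shiftPerm m u = 1 ↔ u = 1 := by
  refine ⟨fun h => ?_, fun h => h ▸ shiftPerm_one m⟩
  ext i
  have := congrArg (fun w : Perm ℕ => w (m + i)) h
  simp only [shiftPerm_apply, Perm.one_apply] at this
  rw [if_neg (by omega), show m + i - m = i by omega] at this
  rw [Perm.one_apply]
  omega

theorem shiftPerm_mul_swap (m : ℕ) (u : Perm ℕ) (i : ℕ) :
    shiftPerm m u * swap (i + m) (i + m + 1) = shiftPerm m (u * swap i (i + 1)) := by
  ext a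
  simp only [Perm.mul_apply, shiftPerm_apply, swap_apply_def]
  split_ifs <;> first | omega | (congr 2; omega)

variable {R : Type*} [CommRing R]

variable (R) in
/-- The linear extension of `shiftPerm`. -/
noncomputable def shiftOp (m : ℕ) : Module.End R (PermModule R) :=
  Finsupp.linearCombination R fun w : Perm ℕ => basisVec R (shiftPerm m w)

theorem shiftOp_basisVec (m : ℕ) (w : Perm ℕ) :
    shiftOp R m (basisVec R w) = basisVec R (shiftPerm m w) := by
  simp [shiftOp]

theorem dOp_mul_shiftOp (m i : ℕ) : dOp R (i + m) * shiftOp R m = shiftOp R m * dOp R i := by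
  refine end_ext fun w => ?_
  have e1 : shiftPerm m w (i + m) = m + w i := by
    rw [shiftPerm_apply, if_neg (by omega), show i + m - m = i by omega]
  have e2 : shiftPerm m w (i + m + 1) = m + w (i + 1) := by
    rw [shiftPerm_apply, if_neg (by omega), show i + m + 1 - m = i + 1 by omega]
  simp only [Module.End.mul_apply, shiftOp_basisVec, dOp_basisVec, e1, e2, add_lt_add_iff_left,
    shiftPerm_mul_swap]
  split_ifs
  · rw [shiftOp_basisVec]
  · rw [map_zero]

theorem coeffOne_shiftOp (m : ℕ) (v : PermModule R) :
    coeffOne R (shiftOp R m v) = coeffOne R v := by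
  refine LinearMap.congr_fun (f := (coeffOne R).comp (shiftOp R m)) (linear_ext fun w => ?_) v
  rw [LinearMap.comp_apply, shiftOp_basisVec, coeffOne_basisVec, coeffOne_basisVec]
  by_cases h : w = 1
  · rw [if_pos h, if_pos (shiftPerm_eq_one_iff.2 h)]
  · rw [if_neg h, if_neg (mt shiftPerm_eq_one_iff.1 h)]

theorem fsProd_mul_shiftOp (N m k : ℕ) (x : ℕ → R) :
    fsProd (dOp R) N m k x * shiftOp R m = shiftOp R m * fsProd (dOp R) (N - m) 0 k x := by
  have h1 : ∀ i (z : R), fac (dOp R) (i + m) z * shiftOp R m = shiftOp R m * fac (dOp R) i z := by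
    intro i z
    simp only [fac, add_mul, mul_add, one_mul, mul_one, smul_mul_assoc, mul_smul_comm,
      dOp_mul_shiftOp]
  have h2 : ∀ n i (z : R), descProd (dOp R) n (i + m) z * shiftOp R m =
      shiftOp R m * descProd (dOp R) n i z := by
    intro n
    induction n with
    | zero => intro i z; simp [descProd]
    | succ n ih =>
      intro i z
      have := ih (i + 1) z
      rw [show i + 1 + m = i + m + 1 by ring] at this
      simp only [descProd]
      rw [mul_assoc, h1, ← mul_assoc, this, mul_assoc]
  induction k with
  | zero => simp [fsProd]
  | succ k ih =>
    simp only [fsProd, zero_add]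
    rw [mul_assoc, show m + k = k + m by ring, show N - (k + m) = N - m - k by omega, h2,
      ← mul_assoc, ih, mul_assoc]

/-- The staircase touches only the positions `j, …, j + k`, so it cannot bring the value `j` down
from position `p`. -/
theorem stairProd_vanish {L : PermModule R →ₗ[R] R} {j : ℕ}
    (hL : ∀ w : Perm ℕ, w j ≠ j → L (basisVec R w) = 0) (c : ℕ → R) {k p : ℕ} (hp : j + k < p)
    {w : Perm ℕ} (hw : w p = j) : L (stairProd (dOp R) j k c (basisVec R w)) = 0 := by
  induction k generalizing w with
  | zero =>
    refine hL w fun h => ?_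
    have := w.injective (h.trans hw.symm)
    omega
  | succ k ih =>
    simp only [stairProd, Module.End.mul_apply]
    rcases lt_or_gt_adj w (j + k) with h | h
    · rw [fac_of_lt h]
      exact ih (by omega) hw
    · rw [fac_of_gt h, map_add, map_add, map_smul, map_smul, ih (by omega) hw, ih (by omega),
        smul_zero, add_zero]
      rw [Perm.mul_apply, swap_apply_of_ne_of_ne (by omega) (by omega), hw]

/-- The value `j` has to travel from position `j + k` to position `j`, one step per factor. A term
not killed by `L` must therefore use the operator, not the `1`, in every factor. -/
theorem stairProd_basisVec {L : PermModule R →ₗ[R] R} {j : ℕ}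
    (hL : ∀ w : Perm ℕ, w j ≠ j → L (basisVec R w) = 0) (c : ℕ → R) {k : ℕ}
    {w : Perm ℕ} (hw : w (j + k) = j) (hlt : ∀ i, j ≤ i → i < j + k → j < w i) :
    L (stairProd (dOp R) j k c (basisVec R w)) =
      (∏ i ∈ Finset.range k, c i) * L (basisVec R (w * cyc j k)) := by
  induction k generalizing w with
  | zero => simp [stairProd, cyc]
  | succ k ih =>
    have hw' : w (j + k + 1) = j := hw
    have h : w (j + k + 1) < w (j + k) := by
      have := hlt (j + k) (by omega) (by omega)
      omega
    simp only [stairProd, Module.End.mul_apply]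
    rw [fac_of_gt h, map_add, map_add, map_smul, map_smul,
      stairProd_vanish hL c (by omega) hw', zero_add, ih, Finset.prod_range_succ, cyc, smul_eq_mul,
      mul_assoc w]
    · ring
    · rw [Perm.mul_apply, swap_apply_left, hw']
    · intro i h1 h2
      rw [Perm.mul_apply, swap_apply_of_ne_of_ne (by omega) (by omega)]
      exact hlt i h1 (by omega)

theorem dOp_mem_supported {i j : ℕ} (hij : i < j) {w : Perm ℕ} (hw : w i ≠ i) :
    dOp R j (basisVec R w) ∈ Finsupp.supported R R {w : Perm ℕ | w i ≠ i} := by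
  rw [dOp_basisVec]
  split_ifs
  · refine Finsupp.single_mem_supported R 1 ?_
    change (w * swap j (j + 1)) i ≠ i
    rwa [Perm.mul_apply, swap_apply_of_ne_of_ne (by omega) (by omega)]
  · exact Submodule.zero_mem _

theorem vanish_of_mem_stable {S : Set (Perm ℕ)} {L : PermModule R →ₗ[R] R}
    {T : Module.End R (PermModule R)} (hT : T ∈ stableSubmonoid R S)
    (hL : ∀ w ∈ S, L (basisVec R w) = 0) {w : Perm ℕ} (hw : w ∈ S) :
    L (T (basisVec R w)) = 0 := by
  have h : Finsupp.supported R R S ≤ LinearMap.ker L := by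
    rw [Finsupp.supported_eq_span_single, Submodule.span_le]
    rintro _ ⟨w, hw, rfl⟩
    exact hL w hw
  exact h (hT _ (Finsupp.single_mem_supported R 1 hw))

theorem incrFrom_shiftPerm_mul_blockPerm {m k n : ℕ} {u : Perm ℕ} (hu : IncrFrom k u)
    (hn : n ≤ m) : IncrFrom (n + k) (shiftPerm m u * blockPerm m k n) := by
  intro i hi
  simp only [Perm.mul_apply, blockPerm_apply (show n ≤ m by omega), shiftPerm_apply]
  by_cases h1 : i + 1 < m + k
  · rw [if_neg (show ¬ i < n by omega), if_neg (show ¬ i < n + k by omega),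
      if_pos (show i < m + k by omega), if_neg (show ¬ i + 1 < n by omega),
      if_neg (show ¬ i + 1 < n + k by omega), if_pos h1, if_pos (by omega), if_pos (by omega)]
    omega
  · rw [if_neg (show ¬ i + 1 < n by omega), if_neg (show ¬ i + 1 < n + k by omega), if_neg h1,
      if_neg (show ¬ i < n by omega), if_neg (show ¬ i < n + k by omega),
      if_neg (show ¬ i + 1 < m by omega)]
    by_cases h2 : i < m + k
    · rw [if_pos h2, if_pos (by omega)]
      omega
    · rw [if_neg h2, if_neg (by omega)]
      have := hu (i - m) (by omega)
      rw [show i + 1 - m = i - m + 1 by omega]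
      omega

/-- Each staircase moves one more of the values below `m` to the front of the block of `k` large
entries. The functional is kept general so that the induction can absorb the operators that act
later; these do not touch the first `n` positions. -/
theorem rectProd_basisVec {N m k n : ℕ} (hn : n ≤ m) {u : Perm ℕ} (hu : IncrFrom k u)
    (x y : ℕ → R) {L : PermModule R →ₗ[R] R}
    (hL : ∀ i < n, ∀ w : Perm ℕ, w i ≠ i → L (basisVec R w) = 0) :
    L (rectProd (dOp R) N k x n y (basisVec R (shiftPerm m u * blockPerm m k 0))) =
      (∏ j ∈ Finset.range n, ∏ i ∈ Finset.range k, (x i + y j)) *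
        L (basisVec R (shiftPerm m u * blockPerm m k n)) := by
  induction n generalizing L with
  | zero => simp [rectProd]
  | succ n ih =>
    set T := stairProd (dOp R) n k (fun j => x j + y n) *
      ascProd (dOp R) (N - (n + k)) (n + k) (y n) with hT
    have hL' : ∀ i < n, ∀ w : Perm ℕ, w i ≠ i → (L ∘ₗ T) (basisVec R w) = 0 := by
      intro i hi w hw
      refine vanish_of_mem_stable (S := {w : Perm ℕ | w i ≠ i}) ?_ (hL i (by omega)) hw
      exact Submonoid.mul_mem _
        (stairProd_mem (d := dOp R) (stableSubmonoid R _) fun j hj _ z =>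
          fac_mem_stableSubmonoid (fun w hw => dOp_mem_supported (by omega) hw) z)
        (ascProd_mem (d := dOp R) (stableSubmonoid R _) fun j hj =>
          fac_mem_stableSubmonoid (fun w hw => dOp_mem_supported (by omega) hw) _)
    have key := ih (by omega) hL'
    rw [LinearMap.comp_apply, LinearMap.comp_apply] at key
    simp only [rectProd, Module.End.mul_apply]
    rw [← Module.End.mul_apply (stairProd _ _ _ _), ← hT, key, hT, Module.End.mul_apply,
      ascProd_of_incrFrom, stairProd_basisVec (hL n (by omega)), mul_assoc (shiftPerm m u),
      blockPerm_mul_cyc hn, Finset.prod_range_succ, mul_assoc]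
    · rw [Perm.mul_apply, blockPerm_apply (by omega), if_neg (by omega), if_neg (by omega),
        if_pos (by omega), shiftPerm_apply, if_pos (by omega)]
      omega
    · intro i h1 h2
      rw [Perm.mul_apply, blockPerm_apply (by omega), if_neg (by omega), if_pos (by omega),
        shiftPerm_apply, if_neg (by omega)]
      omega
    · exact incrFrom_shiftPerm_mul_blockPerm hu (by omega)

/-- The product of a Schubert polynomial with the double Schubert polynomial of a rectangle. -/
theorem schubert_mul_rectangle {N m k : ℕ} {u : Perm ℕ} (hu : IncrFrom k u) (hN : m + k ≤ N)
    (huN : ∀ i, N - m ≤ i → u i = i) (x y : ℕ → R) :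
    evalAt x (schubert u) * ∏ j ∈ Finset.range m, ∏ i ∈ Finset.range k, (x i + y j) =
      coeffOne R (fsProd (dLeft R) N 0 m y (fsProd (dOp R) N 0 k x
        (basisVec R (shiftPerm m u * blockPerm m k 0)))) := by
  -- Operators of index at least `m` leave the first `m` entries alone, so a permutation moving one
  -- of these points never reaches the identity.
  have hL : ∀ i < m, ∀ w : Perm ℕ, w i ≠ i →
      (coeffOne R ∘ₗ fsProd (dOp R) N m k x) (basisVec R w) = 0 := by
    intro i hi w hw
    refine vanish_of_mem_stable (S := {w : Perm ℕ | w i ≠ i}) (L := coeffOne R)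
      (T := fsProd (dOp R) N m k x) ?_ (fun w hw => ?_) hw
    · have hfac : ∀ j, m ≤ j → ∀ z : R, fac (dOp R) j z ∈ stableSubmonoid R {w | w i ≠ i} :=
        fun j hj z => fac_mem_stableSubmonoid (fun w hw => dOp_mem_supported (by omega) hw) z
      exact fsProd_mem (d := dOp R) (stableSubmonoid R _) hfac
    · rw [coeffOne_basisVec, if_neg]
      rintro rfl
      exact hw rfl
  have h := rectProd_basisVec (N := N) le_rfl hu x y hL
  -- The split product is reassembled on one side; on the other, removing the shift `1^m` leaves the
  -- Fomin-Stanley formula for `u`.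
  rw [blockPerm_self, mul_one, LinearMap.comp_apply, LinearMap.comp_apply, ← Module.End.mul_apply,
    ← (isNilCoxeter_dOp (R := R)).revProd_mul_fsProd hN, ← shiftOp_basisVec,
    ← Module.End.mul_apply (fsProd _ _ _ _ _), fsProd_mul_shiftOp, Module.End.mul_apply,
    Module.End.mul_apply, coeffOne_shiftOp,
    ← evalAt_schubert_of_incrFrom x hu (by omega) huN, coeffOne_revProd] at h
  rw [h, mul_comm]

end Rectangle

end Schub

/-! ### Positivity of the product with a Grassmannian Schubert polynomial -/

namespace Schub

open Equiv MvPolynomial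

section Positivity

variable {R : Type*} [CommRing R]

theorem linear_apply_eq_sum (L : PermModule R →ₗ[R] R) (Y : PermModule R) :
    L Y = ∑ w ∈ Y.support, Y w * L (basisVec R w) := by
  conv_lhs => rw [← Finsupp.sum_single Y]
  rw [Finsupp.sum, map_sum]
  refine Finset.sum_congr rfl fun w _ => ?_
  rw [← Finsupp.smul_single_one, map_smul, smul_eq_mul]

theorem fixed_shiftPerm_mul_blockPerm {N m k : ℕ} {u : Perm ℕ} (hN : m + k ≤ N)
    (huN : ∀ i, N - m ≤ i → u i = i) :
    ∀ i, N ≤ i → (shiftPerm m u * blockPerm m k 0) i = i := by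
  intro i hi
  rw [Perm.mul_apply, blockPerm_apply (by omega), if_neg (by omega), if_neg (by omega),
    if_neg (by omega), shiftPerm_apply, if_neg (by omega), huN _ (by omega)]
  omega

/-- The image of a permutation under a Fomin-Stanley product of left operators. -/
noncomputable def leftVec (N l : ℕ) (y : ℕ → R) (W : Perm ℕ) : PermModule R :=
  fsProd (dLeft R) N 0 l y (basisVec R W)

theorem fixed_of_mem_support_leftVec {N l : ℕ} {y : ℕ → R} {W : Perm ℕ}
    (hW : ∀ i, N ≤ i → W i = i) {w : Perm ℕ} (hw : w ∈ (leftVec N l y W).support) :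
    ∀ i, N ≤ i → w i = i :=
  fsProd_dLeft_mem_stable (R := R) N N 0 l y (basisVec R W)
    (Finsupp.single_mem_supported R 1 hW) hw

theorem leftVec_eq (N l : ℕ) (y : ℕ → R) (W : Perm ℕ) : leftVec N l y W =
    invOp R (fsProd (dOp R) N 0 l y (basisVec R W⁻¹)) := by
  rw [leftVec, fsProd_dLeft, Module.End.mul_apply, Module.End.mul_apply, invOp_basisVec]

/-- After inversion the left operators become right operators, and the factors beyond `l` fix `W⁻¹`.
-/
theorem leftVec_congr {N l : ℕ} {y y' : ℕ → R} {W : Perm ℕ} (hW : IncrFrom l W⁻¹) (hl : l ≤ N)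
    (h : ∀ i < l, y i = y' i) : leftVec N l y W = leftVec N N y' W := by
  rw [leftVec_eq, leftVec_eq, fsProd_of_incrFrom hW hl, fsProd_congr (dOp R) h]

/-- The Schubert expansion of the product with a rectangle. -/
theorem schubert_mul_rectangle_eq_sum {N m k : ℕ} {u : Perm ℕ} (hu : IncrFrom k u)
    (hN : m + k ≤ N) (huN : ∀ i, N - m ≤ i → u i = i) (x y : ℕ → R) :
    evalAt x (schubert u) * ∏ j ∈ Finset.range m, ∏ i ∈ Finset.range k, (x i + y j) =
      ∑ w ∈ (leftVec N m y (shiftPerm m u * blockPerm m k 0)).support,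
        leftVec N m y (shiftPerm m u * blockPerm m k 0) w * evalAt x (schubert w) := by
  set W := shiftPerm m u * blockPerm m k 0 with hW
  have hWN : ∀ i, N ≤ i → W i = i := fixed_shiftPerm_mul_blockPerm hN huN
  have hinc : IncrFrom k W := by
    simpa using incrFrom_shiftPerm_mul_blockPerm (n := 0) hu (Nat.zero_le m)
  have hcomm : Commute (fsProd (dLeft R) N 0 m y) (fsProd (dOp R) N 0 N x) :=
    commute_fsProd (fun j _ => (commute_fsProd (fun l _ => dOp_commute_dLeft j l) N m y).symm) N N x
  rw [schubert_mul_rectangle hu hN huN, ← hW, ← fsProd_of_incrFrom hinc (by omega : k ≤ N),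
    ← Module.End.mul_apply, hcomm.eq, Module.End.mul_apply, ← leftVec, ← LinearMap.comp_apply,
    linear_apply_eq_sum]
  refine Finset.sum_congr rfl fun w hw => ?_
  rw [LinearMap.comp_apply, evalAt_schubert x (fixed_of_mem_support_leftVec hWN hw)]

/-- The operator extracting the coefficient of `v` commutes with the left operators. Applied to `W`
first, it leaves zero or the single permutation `W * v⁻¹`, and the rest is the Fomin-Stanley formula
for the inverse of that permutation. -/
theorem leftVec_apply {N l : ℕ} {y : ℕ → R} {W v : Perm ℕ} (hW : ∀ i, N ≤ i → W i = i)
    (hv : ∀ i, N ≤ i → v i = i) (hl : l ≤ N) (hy : ∀ i, l ≤ i → i < N → y i = 0) :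
    (leftVec N l y W v = 0 ∨ leftVec N l y W v = evalAt y (schubert (v * W⁻¹))) ∧
    (inversions v ⊆ inversions W → leftVec N l y W v = evalAt y (schubert (v * W⁻¹))) := by
  obtain ⟨T, h1, h2, h3, h4⟩ := exists_coeff_operator (R := R) v (mem_finPerm_of_fixed hv)
  have hcomm : Commute T (fsProd (dLeft R) N 0 l y) := commute_fsProd (fun j _ => h1 j) N l y
  have e1 : leftVec N l y W v = coeffOne R (fsProd (dLeft R) N 0 l y (T (basisVec R W))) := by
    rw [← h2, leftVec, ← Module.End.mul_apply, hcomm.eq, Module.End.mul_apply]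
  have hfix : ∀ i, N ≤ i → (v * W⁻¹) i = i := fun i hi => by
    rw [Perm.mul_apply, Perm.inv_eq_iff_eq.2 (hW i hi).symm, hv i hi]
  have e2 : T (basisVec R W) = basisVec R (W * v⁻¹) →
      leftVec N l y W v = evalAt y (schubert (v * W⁻¹)) := by
    intro h
    rw [e1, h, ← leftVec, leftVec_eq, coeffOne_invOp, mul_inv_rev, inv_inv,
      evalAt_schubert y hfix, fsProd_eq_of_zero _ hl hy]
  refine ⟨?_, fun h => e2 (h4 W h)⟩
  rcases h3 W with h | h
  · left
    rw [e1, h, map_zero, map_zero]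
  · exact Or.inr (e2 h)

/-- The permutations whose only descent is between the positions `k - 1` and `k`. -/
def grassmannians (k : ℕ) : Set (Perm ℕ) :=
  {g | g ∈ FinPerm ∧ IncrFrom k g ∧ ∀ i, i + 1 < k → g i < g (i + 1)}

theorem lt_of_mem_grassmannians {k : ℕ} {g : Perm ℕ} (hg : g ∈ grassmannians k) {a b : ℕ}
    (hab : a < b) (hb : b < k) : g a < g b := by
  induction b, hab using Nat.le_induction with
  | base => exact hg.2.2 a hb
  | succ b hb' ih => exact (ih (by omega)).trans (hg.2.2 b (by omega))

/-- An inversion of `g` pairs a position below `k` with one in `[k, m + k)`, and the exchange of the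
blocks inverts every such pair. -/
theorem inversions_subset_blockPerm {m k : ℕ} {g : Perm ℕ} (hg : g ∈ grassmannians k)
    (hgN : ∀ i, m + k ≤ i → g i = i) : inversions g ⊆ inversions (blockPerm m k 0) := by
  rintro ⟨a, b⟩ ⟨h1, h2⟩
  simp only at h1 h2
  have hak : a < k := by
    by_contra h
    have := hg.2.1.lt (show k ≤ a by omega) h1
    omega
  have hbk : k ≤ b := by
    by_contra h
    have := lt_of_mem_grassmannians hg h1 (by omega)
    omega
  have hbm : b < m + k := by
    by_contra h
    have h3 := lt_of_fixed hgN (show a < m + k by omega)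
    have h4 := hgN b (by omega)
    omega
  refine ⟨h1, ?_⟩
  rw [blockPerm_apply (by omega), blockPerm_apply (by omega)]
  simp only
  split_ifs <;> omega

theorem map_trunc (m : ℕ) (f : MvPolynomial ℕ ℤ) :
    evalAt (fun j => if j < m then (X j : MvPolynomial ℕ R) else 0) f =
      map (Int.castRingHom R) (trunc m f) := by
  refine (RingHom.congr_fun (eq_evalAt ((map (Int.castRingHom R)).comp (trunc m)) fun i => ?_) f).symm
  rw [RingHom.comp_apply, trunc, evalAt_X]
  split_ifs <;> simp

theorem evalAt_X_eq_map (f : MvPolynomial ℕ ℤ) :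
    evalAt (X : ℕ → MvPolynomial ℕ R) f = map (Int.castRingHom R) f :=
  (RingHom.congr_fun (eq_evalAt (map (Int.castRingHom R)) fun i => by simp) f).symm

theorem evalAt_C_comp_X (f : MvPolynomial ℕ ℤ) :
    evalAt (fun i => (C (X i) : MvPolynomial ℕ (MvPolynomial ℕ ℤ))) f = C f :=
  (RingHom.congr_fun (eq_evalAt C fun _ => rfl) f).symm

/-- The cone of nonnegative combinations of Schubert polynomials. -/
noncomputable def schubertCone : AddSubmonoid (MvPolynomial ℕ ℤ) :=
  AddSubmonoid.closure (schubert '' {v | v ∈ FinPerm})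

theorem schubert_mem_cone {w : Perm ℕ} (hw : w ∈ FinPerm) : schubert w ∈ schubertCone :=
  AddSubmonoid.subset_closure ⟨w, hw, rfl⟩

/-- A dual functional takes nonnegative integer values on nonnegative combinations. -/
theorem dual_functional_natCast {κ : MvPolynomial ℕ R →ₗ[R] R}
    (hκ : ∀ w ∈ FinPerm, ∃ n : ℕ, κ (map (Int.castRingHom R) (schubert w)) = n)
    {f : MvPolynomial ℕ ℤ} (hf : f ∈ schubertCone) :
    ∃ n : ℕ, κ (map (Int.castRingHom R) f) = n := by
  induction hf using AddSubmonoid.closure_induction with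
  | mem f hf =>
    obtain ⟨w, hw, rfl⟩ := hf
    exact hκ w hw
  | zero => exact ⟨0, by simp⟩
  | add f g _ _ h1 h2 =>
    obtain ⟨a, ha⟩ := h1
    obtain ⟨b, hb⟩ := h2
    exact ⟨a + b, by rw [map_add, map_add, ha, hb, Nat.cast_add]⟩

theorem trunc_mem_cone {m : ℕ} {w : Perm ℕ} (hw : w ∈ FinPerm) :
    trunc m (schubert w) ∈ schubertCone :=
  AddSubmonoid.closure_mono (Set.image_mono fun _ h => h.1) (trunc_schubert_mem hw)

theorem fixed_blockPerm {m k i : ℕ} (h : m + k ≤ i) : blockPerm m k 0 i = i := by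
  rw [blockPerm_apply (by omega), if_neg (by omega), if_neg (by omega), if_neg (by omega)]

/-- The product with the Schubert polynomial of a Grassmannian permutation is positive. -/
theorem schubert_mul_grassmannian_mem {k : ℕ} {u g : Perm ℕ} (hu : u ∈ FinPerm)
    (huk : IncrFrom k u) (hg : g ∈ grassmannians k) :
    schubert u * schubert g ∈ schubertCone := by
  classical
  obtain ⟨M, hkM, hM⟩ := exists_bounds hg.1 k
  obtain ⟨m, rfl⟩ := Nat.exists_eq_add_of_le' hkM
  obtain ⟨N', hN', huN'⟩ := exists_bounds hu k
  set N := N' + m with hNdef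
  have hN : m + k ≤ N := by omega
  have huN : ∀ i, N - m ≤ i → u i = i := fun i hi => huN' i (by omega)
  set W := blockPerm m k 0 with hW
  have hWN : ∀ i, N ≤ i → W i = i := fun i hi => fixed_blockPerm (by omega)
  have hWmem : W ∈ FinPerm := mem_finPerm_of_fixed hWN
  -- The outer polynomial variables play the role of `y`, while the `x` variables lie in the
  -- coefficient ring. So `κ` acts on `y` only and is linear over the polynomials in `x`.
  obtain ⟨κ, hκ⟩ := exists_dual_functional (MvPolynomial ℕ ℤ)
    (FinPerm.mul_mem hg.1 (FinPerm.inv_mem hWmem))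
  have hκC : ∀ f a, κ (f * C a) = a * κ f := fun f a => by
    rw [mul_comm, ← smul_eq_C_mul, map_smul, smul_eq_mul]
  set x : ℕ → MvPolynomial ℕ (MvPolynomial ℕ ℤ) := fun i => C (X i) with hx
  set y : ℕ → MvPolynomial ℕ (MvPolynomial ℕ ℤ) := fun j => if j < m then X j else 0 with hy
  set P := ∏ j ∈ Finset.range m, ∏ i ∈ Finset.range k, (x i + y j) with hP
  have hone : κ P = schubert g := by
    have h2 := schubert_mul_rectangle_eq_sum (N := N) (u := 1)
      (fun i _ => by simp) hN (fun _ _ => rfl) x y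
    -- For `u = 1` the truncation of `y` has no effect, so the coefficients are zero or full
    -- Schubert polynomials, on which `κ` is known; it keeps only the term of `g`.
    have hWinv : IncrFrom m W⁻¹ := fun i hi => by
      rw [hW, blockPerm_inv_apply, blockPerm_inv_apply]
      split_ifs <;> omega
    rw [schubert_one, map_one, one_mul, ← hP, shiftPerm_one, one_mul, ← hW,
      leftVec_congr (y' := X) hWinv (by omega) fun i hi => if_pos hi] at h2
    have hval : ∀ w, (∀ i, N ≤ i → w i = i) →
        κ (leftVec N N (X : ℕ → MvPolynomial ℕ (MvPolynomial ℕ ℤ)) W w) =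
          if w = g then 1 else 0 := by
      intro w hw
      obtain ⟨h3, h4⟩ := leftVec_apply (y := (X : ℕ → MvPolynomial ℕ (MvPolynomial ℕ ℤ)))
        hWN hw le_rfl (fun i h5 h6 => by omega)
      have hmem : w * W⁻¹ ∈ FinPerm :=
        FinPerm.mul_mem (mem_finPerm_of_fixed hw) (FinPerm.inv_mem hWmem)
      by_cases hwg : w = g
      · subst hwg
        rw [h4 (inversions_subset_blockPerm hg hM), evalAt_X_eq_map, hκ _ hmem, if_pos rfl,
          if_pos rfl]
      · rw [if_neg hwg]
        rcases h3 with h3 | h3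
        · rw [h3, map_zero]
        · rw [h3, evalAt_X_eq_map, hκ _ hmem, if_neg fun h => hwg (mul_right_cancel h)]
    rw [h2, map_sum, Finset.sum_eq_single g]
    · rw [hx, evalAt_C_comp_X, hκC, hval g fun i hi => hM i (by omega), if_pos rfl, mul_one]
    · intro w hw hwg
      rw [hx, evalAt_C_comp_X, hκC, hval w (fixed_of_mem_support_leftVec hWN hw), if_neg hwg,
        mul_zero]
    · intro h
      rw [Finsupp.notMem_support_iff.1 h, zero_mul, map_zero]
  have h3 := congrArg κ (schubert_mul_rectangle_eq_sum huk hN huN x y)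
  rw [hx, evalAt_C_comp_X, ← hx, ← hP, mul_comm, hκC, hone, map_sum] at h3
  rw [h3]
  have hVN : ∀ i, N ≤ i → (shiftPerm m u * W) i = i := fixed_shiftPerm_mul_blockPerm hN huN
  refine AddSubmonoid.sum_mem _ fun w hw => ?_
  have hwN := fixed_of_mem_support_leftVec hVN hw
  have hwmem := mem_finPerm_of_fixed hwN
  -- For general `u` the coefficient may be a truncated Schubert polynomial; by transition it is
  -- still a nonnegative combination of Schubert polynomials.
  obtain ⟨n, hn⟩ : ∃ n : ℕ, κ (leftVec N m y (shiftPerm m u * W) w) = n := by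
    rcases (leftVec_apply (l := m) (y := y) hVN hwN (by omega) fun i h5 _ => if_neg (by omega)).1 with h | h
    · exact ⟨0, by rw [h, map_zero, Nat.cast_zero]⟩
    · rw [h, hy, map_trunc]
      refine dual_functional_natCast (fun v hv => ?_) (trunc_mem_cone
        (FinPerm.mul_mem hwmem (FinPerm.inv_mem (mem_finPerm_of_fixed hVN))))
      rw [hκ v hv]
      split_ifs
      · exact ⟨1, by simp⟩
      · exact ⟨0, by simp⟩
  rw [hx, evalAt_C_comp_X, hκC, hn, mul_comm, ← nsmul_eq_mul]
  exact AddSubmonoid.nsmul_mem _ (schubert_mem_cone hwmem) n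

end Positivity

end Schub

/-! ### Schubert expansions and chains in the `k`-Bruhat order -/

namespace Schub

open Equiv MvPolynomial

section Chains

theorem exists_dual_functional_int {v : Perm ℕ} (hv : v ∈ FinPerm) :
    ∃ κ : MvPolynomial ℕ ℤ →ₗ[ℤ] ℤ, κ (schubert v) = 1 ∧
      ∀ w ∈ FinPerm, w ≠ v → κ (schubert w) = 0 := by
  obtain ⟨κ, hκ⟩ := exists_dual_functional ℤ hv
  have hid : ∀ f : MvPolynomial ℕ ℤ, map (Int.castRingHom ℤ) f = f := fun f => by
    rw [RingHom.ext_int (Int.castRingHom ℤ) (RingHom.id ℤ), map_id]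
  refine ⟨κ, ?_, fun w hw hne => ?_⟩
  · have := hκ v hv
    rwa [hid, if_pos rfl] at this
  · have := hκ w hw
    rwa [hid, if_neg hne] at this

theorem dual_functional_nonneg {v : Perm ℕ} {κ : MvPolynomial ℕ ℤ →ₗ[ℤ] ℤ}
    (h1 : κ (schubert v) = 1) (h2 : ∀ w ∈ FinPerm, w ≠ v → κ (schubert w) = 0)
    {f : MvPolynomial ℕ ℤ} (hf : f ∈ schubertCone) : 0 ≤ κ f := by
  induction hf using AddSubmonoid.closure_induction with
  | mem f hf =>
    obtain ⟨w, hw, rfl⟩ := hf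
    by_cases h : w = v
    · rw [h, h1]
      exact zero_le_one
    · rw [h2 w hw h]
  | zero => simp
  | add f g _ _ hf hg =>
    rw [map_add]
    exact add_nonneg hf hg

/-- Elements of the cone have nonnegative coefficients. -/
theorem exists_coefficients {f : MvPolynomial ℕ ℤ} (hf : f ∈ schubertCone) :
    ∃ c : FinPerm →₀ ℤ, f = c.sum fun w m => m • schubert w := by
  induction hf using AddSubmonoid.closure_induction with
  | mem f hf =>
    obtain ⟨w, hw, rfl⟩ := hf
    exact ⟨Finsupp.single ⟨w, hw⟩ 1, by simp⟩
  | zero => exact ⟨0, by simp⟩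
  | add f g _ _ hf hg =>
    obtain ⟨c, rfl⟩ := hf
    obtain ⟨c', rfl⟩ := hg
    exact ⟨c + c', by rw [Finsupp.sum_add_index'] <;> simp [add_smul]⟩

theorem dual_functional_sum {v : FinPerm} {κ : MvPolynomial ℕ ℤ →ₗ[ℤ] ℤ}
    (h1 : κ (schubert v) = 1) (h2 : ∀ w ∈ FinPerm, w ≠ v → κ (schubert w) = 0)
    (c : FinPerm →₀ ℤ) : κ (c.sum fun w m => m • schubert w) = c v := by
  rw [Finsupp.sum, map_sum, Finset.sum_eq_single v]
  · rw [map_smul, h1, smul_eq_mul, mul_one]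
  · intro w _ hw
    rw [map_smul, h2 w w.2 fun h => hw (Subtype.ext h), smul_zero]
  · intro h
    rw [Finsupp.notMem_support_iff.1 h, zero_smul, map_zero]

/-- Chains in the `k`-Bruhat order starting at `u`. -/
def IsBruhatChain (k n : ℕ) (u : Perm ℕ) (t : List (ℕ × ℕ)) : Prop :=
  t.length = n ∧ (∀ p ∈ t, p.1 < k ∧ k ≤ p.2) ∧
    ∀ i ≤ n, len (u * swapProd (t.take i)) = len u + i

theorem swapProd_mem (t : List (ℕ × ℕ)) : swapProd t ∈ FinPerm :=
  FinPerm.list_prod_mem fun x hx => by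
    obtain ⟨p, -, rfl⟩ := List.mem_map.1 hx
    exact swap_mem _ _

theorem swapProd_cons (p : ℕ × ℕ) (t : List (ℕ × ℕ)) :
    swapProd (p :: t) = swap p.1 p.2 * swapProd t := by
  simp [swapProd]

theorem mem_coverSet {k B : ℕ} {w : Perm ℕ} {p : ℕ × ℕ} :
    p ∈ coverSet k B w ↔ p.1 < k ∧ k ≤ p.2 ∧ p.2 < B ∧ IsCover w p.1 p.2 := by
  simp only [coverSet, Finset.mem_filter, Finset.mem_product, Finset.mem_range, Finset.mem_Ico]
  tauto

/-- Iterated Monk formula. -/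
theorem exists_chains (k n : ℕ) {u : Perm ℕ} (hu : u ∈ FinPerm) :
    ∃ T : Finset (List (ℕ × ℕ)), (∀ t ∈ T, IsBruhatChain k n u t) ∧
      (∑ r ∈ Finset.range k, X r) ^ n * schubert u = ∑ t ∈ T, schubert (u * swapProd t) := by
  classical
  induction n generalizing u with
  | zero =>
    refine ⟨{[]}, fun t ht => ?_, by simp [swapProd]⟩
    rw [Finset.mem_singleton.1 ht]
    refine ⟨rfl, by simp, fun i hi => ?_⟩
    rw [Nat.le_zero.1 hi]
    simp [swapProd]
  | succ n ih =>
    obtain ⟨N, hkN, hN⟩ := exists_bounds hu k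
    choose T hT using fun p : ℕ × ℕ => ih (mul_swap_mem hu p.1 p.2)
    refine ⟨(coverSet k (N + 1) u).biUnion fun p => (T p).image (List.cons p), ?_, ?_⟩
    · intro t ht
      obtain ⟨p, hp, ht⟩ := Finset.mem_biUnion.1 ht
      obtain ⟨t, ht', rfl⟩ := Finset.mem_image.1 ht
      obtain ⟨h1, h2, h3⟩ := (hT p).1 t ht'
      obtain ⟨h4, h5, -, h6⟩ := mem_coverSet.1 hp
      refine ⟨by rw [List.length_cons, h1], fun q hq => ?_, fun i hi => ?_⟩
      · rcases List.mem_cons.1 hq with rfl | hq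
        · exact ⟨h4, h5⟩
        · exact h2 q hq
      · cases i with
        | zero => simp [swapProd]
        | succ i =>
          rw [List.take_succ_cons, swapProd_cons, ← mul_assoc, h3 i (by omega),
            h6.len_mul_swap hu]
          ring
    · rw [pow_succ, mul_assoc, monk_sum hN (Nat.lt_succ_self N) (by omega), Finset.mul_sum,
        Finset.sum_biUnion]
      · refine Finset.sum_congr rfl fun p _ => ?_
        rw [(hT p).2, Finset.sum_image fun a _ b _ h => List.cons_injective h]
        exact Finset.sum_congr rfl fun t _ => by rw [swapProd_cons, mul_assoc]
      · intro p _ q _ hpq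
        rw [Function.onFun, Finset.disjoint_left]
        rintro t h1 h2
        obtain ⟨a, -, rfl⟩ := Finset.mem_image.1 h1
        obtain ⟨b, -, h⟩ := Finset.mem_image.1 h2
        exact hpq (List.cons_eq_cons.1 h).1.symm

end Chains

/-! ### Grassmannian permutations and powers of the linear Schubert polynomial -/

section Grassmannian

/-- The cover condition forces the entry after `a`, within the first `k`, above `g b`, and the entry
before `b`, from position `k` on, below `g a`. -/
theorem mul_swap_mem_grassmannians {k : ℕ} {g : Perm ℕ} (hg : g ∈ grassmannians k) {a b : ℕ}
    (ha : a < k) (hb : k ≤ b) (h : IsCover g a b) : g * swap a b ∈ grassmannians k := by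
  obtain ⟨hab, hlt, hc⟩ := h
  have e : ∀ i, (g * swap a b) i = if i = a then g b else if i = b then g a else g i := by
    intro i
    rw [Perm.mul_apply, swap_apply_def]
    split_ifs <;> rfl
  refine ⟨mul_swap_mem hg.1 _ _, fun i hi => ?_, fun i hi => ?_⟩
  · have h1 := hg.2.1 i hi
    have h2 := hc i
    rw [e, e, if_neg (show ¬ i = a by omega), if_neg (show ¬ i + 1 = a by omega)]
    by_cases h3 : i = b
    · subst h3
      rw [if_pos rfl, if_neg (show ¬ i + 1 = i by omega)]
      omega
    · rw [if_neg h3]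
      split_ifs with h4
      · subst h4
        omega
      · exact h1
  · have h1 := hg.2.2 i hi
    have h2 := hc (i + 1)
    rw [e, e, if_neg (show ¬ i = b by omega), if_neg (show ¬ i + 1 = b by omega)]
    by_cases h3 : i = a
    · subst h3
      rw [if_pos rfl, if_neg (show ¬ i + 1 = i by omega)]
      omega
    · rw [if_neg h3]
      split_ifs with h4
      · rw [h4] at h1
        omega
      · exact h1

/-- Some consecutive values `j + 1` and `j` occur out of order, necessarily on the two sides of the
descent. No value lies between them, so exchanging them disturbs no other comparison and gives a
cover. -/
theorem exists_lower_grassmannian {k : ℕ} {g : Perm ℕ} (hg : g ∈ grassmannians k) (h1 : g ≠ 1) :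
    ∃ g' ∈ grassmannians k, ∃ a b, a < k ∧ k ≤ b ∧ IsCover g' a b ∧ g' * swap a b = g := by
  obtain ⟨j, hj⟩ : ∃ j, g⁻¹ (j + 1) < g⁻¹ j := by
    by_contra hcon
    push Not at hcon
    refine h1 (inv_eq_one.1 (eq_one_of_increasing fun i => ?_))
    exact (lt_or_gt_adj g⁻¹ i).resolve_right (not_lt.2 (hcon i))
  set a := g⁻¹ (j + 1) with ha
  set b := g⁻¹ j with hb
  have ga : g a = j + 1 := by simp [a]
  have gb : g b = j := by simp [b]
  have hak : a < k := by
    by_contra h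
    have := hg.2.1.lt (show k ≤ a by omega) hj
    omega
  have hbk : k ≤ b := by
    by_contra h
    have := lt_of_mem_grassmannians hg hj (by omega)
    omega
  have gne : ∀ i, i ≠ a → i ≠ b → g i ≠ j + 1 ∧ g i ≠ j := fun i hia hib =>
    ⟨fun h => hia (g.injective (h.trans ga.symm)), fun h => hib (g.injective (h.trans gb.symm))⟩
  have e : ∀ i, (g * swap a b) i = if i = a then j else if i = b then j + 1 else g i := by
    intro i
    rw [Perm.mul_apply, swap_apply_def]
    split_ifs
    · exact gb
    · exact ga
    · rfl
  refine ⟨g * swap a b, ⟨mul_swap_mem hg.1 _ _, fun i hi => ?_, fun i hi => ?_⟩, a, b, hak, hbk,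
    ⟨hj, ?_, fun c h2 h3 => ?_⟩, mul_swap_swap g a b⟩
  · have h2 := hg.2.1 i hi
    rw [e, e, if_neg (show ¬ i = a by omega), if_neg (show ¬ i + 1 = a by omega)]
    by_cases h3 : i = b
    · rw [if_pos h3, if_neg (show ¬ i + 1 = b by omega)]
      rw [h3, gb] at h2
      have := (gne (b + 1) (by omega) (by omega)).1
      rw [h3]
      omega
    · rw [if_neg h3]
      split_ifs with h4
      · rw [h4, gb] at h2
        omega
      · exact h2
  · have h2 := hg.2.2 i hi
    rw [e, e, if_neg (show ¬ i = b by omega), if_neg (show ¬ i + 1 = b by omega)]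
    by_cases h3 : i = a
    · rw [if_pos h3, if_neg (show ¬ i + 1 = a by omega)]
      rw [h3, ga] at h2
      rw [h3]
      omega
    · rw [if_neg h3]
      split_ifs with h4
      · rw [h4, ga] at h2
        have := (gne i h3 (by omega)).2
        omega
      · exact h2
  · rw [e, e, if_pos rfl, if_neg (show ¬ b = a by omega), if_pos rfl]
    omega
  · rw [e, e, e, if_pos rfl, if_neg (show ¬ b = a by omega), if_pos rfl,
      if_neg (show ¬ c = a by omega), if_neg (show ¬ c = b by omega)]
    have := gne c (by omega) (by omega)
    omega

/-- The cone of the Grassmannian Schubert polynomials. -/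
noncomputable def grassmannianCone (k : ℕ) : AddSubmonoid (MvPolynomial ℕ ℤ) :=
  AddSubmonoid.closure (schubert '' grassmannians k)

theorem schubert_mem_grassmannianCone {k : ℕ} {g : Perm ℕ} (hg : g ∈ grassmannians k) :
    schubert g ∈ grassmannianCone k := AddSubmonoid.subset_closure ⟨g, hg, rfl⟩

theorem sum_X_mul_mem {k : ℕ} {f : MvPolynomial ℕ ℤ} (hf : f ∈ grassmannianCone k) :
    (∑ r ∈ Finset.range k, X r) * f ∈ grassmannianCone k := by
  induction hf using AddSubmonoid.closure_induction with
  | mem f hf =>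
    obtain ⟨g, hg, rfl⟩ := hf
    obtain ⟨N, hkN, hN⟩ := exists_bounds hg.1 k
    rw [monk_sum hN (Nat.lt_succ_self N) (by omega)]
    refine AddSubmonoid.sum_mem _ fun p hp => ?_
    obtain ⟨h1, h2, -, h3⟩ := mem_coverSet.1 hp
    exact schubert_mem_grassmannianCone (mul_swap_mem_grassmannians hg h1 h2 h3)
  | zero => rw [mul_zero]; exact zero_mem _
  | add f g _ _ hf hg => rw [mul_add]; exact add_mem hf hg

/-- Every Grassmannian Schubert polynomial occurs in the power of the linear one. -/
theorem pow_eq_schubert_add {k : ℕ} {g : Perm ℕ} (hg : g ∈ grassmannians k) :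
    ∃ f ∈ grassmannianCone k, (∑ r ∈ Finset.range k, X r) ^ len g = schubert g + f := by
  induction hn : len g generalizing g with
  | zero =>
    have : g = 1 := by
      by_contra h
      obtain ⟨g', hg', a, b, -, -, h3, h4⟩ := exists_lower_grassmannian hg h
      have := h3.len_mul_swap hg'.1
      rw [h4] at this
      omega
    exact ⟨0, zero_mem _, by rw [this, schubert_one, pow_zero, add_zero]⟩
  | succ n ih =>
    have hne : g ≠ 1 := fun h => by
      rw [h, len_one] at hn
      omega
    obtain ⟨g', hg', a, b, h1, h2, h3, h4⟩ := exists_lower_grassmannian hg hne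
    have hlen := h3.len_mul_swap hg'.1
    rw [h4] at hlen
    obtain ⟨f, hf, hpow⟩ := ih hg' (by omega)
    obtain ⟨N, hkN, hN⟩ := exists_bounds hg'.1 (k + b)
    have hmem : (a, b) ∈ coverSet k (N + 1) g' := mem_coverSet.2 ⟨h1, h2, by simp only; omega, h3⟩
    refine ⟨∑ p ∈ (coverSet k (N + 1) g').erase (a, b), schubert (g' * swap p.1 p.2) +
      (∑ r ∈ Finset.range k, X r) * f,
      add_mem (AddSubmonoid.sum_mem _ fun p hp => ?_) (sum_X_mul_mem hf), ?_⟩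
    · obtain ⟨h5, h6, -, h7⟩ := mem_coverSet.1 (Finset.mem_of_mem_erase hp)
      exact schubert_mem_grassmannianCone (mul_swap_mem_grassmannians hg' h5 h6 h7)
    · rw [pow_succ', hpow, mul_add, monk_sum hN (Nat.lt_succ_self N) (by omega),
        ← Finset.add_sum_erase _ _ hmem, h4, add_assoc]

theorem schubert_mul_grassmannianCone {k : ℕ} {u : Perm ℕ} (hu : u ∈ FinPerm)
    (huk : IncrFrom k u) {f : MvPolynomial ℕ ℤ} (hf : f ∈ grassmannianCone k) :
    schubert u * f ∈ schubertCone := by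
  induction hf using AddSubmonoid.closure_induction with
  | mem f hf =>
    obtain ⟨g, hg, rfl⟩ := hf
    exact schubert_mul_grassmannian_mem hu huk hg
  | zero => rw [mul_zero]; exact zero_mem _
  | add f g _ _ hf hg => rw [mul_add]; exact add_mem hf hg

theorem grass_mem_grassmannians (lam : YoungDiagram) (k : ℕ) (h : lam.colLen 0 ≤ k) :
    (grass lam k h : Perm ℕ) ∈ grassmannians k := by
  refine ⟨(grass lam k h).2, fun i hi => grass_lt lam k h i hi, fun i hi => ?_⟩
  rw [grass_apply lam k h i (by omega), grass_apply lam k h (i + 1) hi]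
  have := lam.rowLen_anti (k - 1 - (i + 1)) (k - 1 - i) (by omega)
  omega

/-- The cell in row `i` and column `j` corresponds to the inversion of the positions `k - 1 - i` and
`k + j`. -/
theorem len_grass (lam : YoungDiagram) (k : ℕ) (h : lam.colLen 0 ≤ k) :
    len (grass lam k h : Perm ℕ) = lam.card := by
  have hG := grass_mem_grassmannians lam k h
  have happ : ∀ j, (grass lam k h : Perm ℕ) (k + j) = k + j - lam.colLen j := by
    intro j
    simp only [grass, grassFun, Equiv.ofBijective_apply]
    rw [if_neg (by omega), Nat.add_sub_cancel_left]
  have hset : inversions (grass lam k h : Perm ℕ) =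
      (fun c : ℕ × ℕ => (k - 1 - c.1, k + c.2)) '' (lam.cells : Set (ℕ × ℕ)) := by
    ext ⟨a, b⟩
    simp only [inversions, Set.mem_ofPred_eq, Set.mem_image, Finset.mem_coe, YoungDiagram.mem_cells,
      Prod.exists, Prod.mk.injEq]
    constructor
    · rintro ⟨h1, h2⟩
      have hak : a < k := by
        by_contra hle
        have := hG.2.1.lt (show k ≤ a by omega) h1
        omega
      have hbk : k ≤ b := by
        by_contra hle
        have := lt_of_mem_grassmannians hG h1 (by omega)
        omega
      obtain ⟨j, rfl⟩ := Nat.exists_eq_add_of_le hbk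
      rw [happ, grass_apply lam k h a hak] at h2
      refine ⟨k - 1 - a, j, ?_, by omega, rfl⟩
      by_contra hmem
      have h3 := mt lam.mem_iff_lt_rowLen.2 hmem
      have h4 := mt lam.mem_iff_lt_colLen.2 hmem
      omega
    · rintro ⟨i, j, hmem, rfl, rfl⟩
      have h3 := lam.mem_iff_lt_rowLen.1 hmem
      have h4 := lam.mem_iff_lt_colLen.1 hmem
      have h5 := colLen_le lam k h j
      refine ⟨by omega, ?_⟩
      rw [happ, grass_apply lam k h _ (by omega), show k - 1 - (k - 1 - i) = i by omega]
      omega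
  rw [len_eq_ncard, hset, Set.InjOn.ncard_image, Set.ncard_coe_finset]
  · rintro ⟨i, j⟩ h1 ⟨i', j'⟩ h2 heq
    simp only [Finset.mem_coe, YoungDiagram.mem_cells] at h1 h2
    simp only [Prod.mk.injEq] at heq ⊢
    have h3 := lam.mem_iff_lt_colLen.1 h1
    have h4 := lam.mem_iff_lt_colLen.1 h2
    have h5 := colLen_le lam k h j
    have h6 := colLen_le lam k h j'
    omega

end Grassmannian

end Schub

/-! ### Structure constants as numbers of chains -/

theorem mainTheorem5 (k : ℕ) (hk : 0 < k)
    (u : Schub.FinPerm)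
    (hu : ∀ i : ℕ, k ≤ i → (u : Equiv.Perm ℕ) i < (u : Equiv.Perm ℕ) (i + 1))
    (lam : YoungDiagram) (hlam : lam.colLen 0 ≤ k) :
    ∃ c : Schub.FinPerm →₀ ℤ,
      Schub.IsStructureConstants u (Schub.grass lam k hlam) c ∧
      (∀ c' : Schub.FinPerm →₀ ℤ,
        Schub.IsStructureConstants u (Schub.grass lam k hlam) c' → c' = c) ∧
      ∀ w : Schub.FinPerm,
        0 ≤ c w ∧
        ∃ S : Finset (List (ℕ × ℕ)),
          (∀ t ∈ S, Schub.IsChain k lam.card u w t) ∧ c w = (S.card : ℤ) := by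
  classical
  have hg := Schub.grass_mem_grassmannians lam k hlam
  have hpos := Schub.schubert_mul_grassmannian_mem u.2 hu hg
  obtain ⟨c, hc⟩ := Schub.exists_coefficients hpos
  refine ⟨c, hc, fun c' hc' => ?_, fun w => ?_⟩
  · ext w
    obtain ⟨κ, h1, h2⟩ := Schub.exists_dual_functional_int w.2
    rw [← Schub.dual_functional_sum h1 h2, ← Schub.dual_functional_sum h1 h2 c, ← hc]
    exact congrArg κ hc'.symm
  obtain ⟨κ, h1, h2⟩ := Schub.exists_dual_functional_int w.2
  have hcw : κ (Schub.schubert u * Schub.schubert (Schub.grass lam k hlam)) = c w := by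
    rw [hc, Schub.dual_functional_sum h1 h2]
  have hnn : 0 ≤ c w := hcw ▸ Schub.dual_functional_nonneg h1 h2 hpos
  obtain ⟨f, hf, hpow⟩ := Schub.pow_eq_schubert_add hg
  obtain ⟨T, hT, hsum⟩ := Schub.exists_chains k lam.card u.2
  rw [Schub.len_grass] at hpow
  -- Applied to the iterated Monk formula, `κ` counts the chains that end at `w`.
  have hcount : κ (∑ t ∈ T, Schub.schubert (u * Schub.swapProd t)) =
      ((T.filter fun t => (w : Equiv.Perm ℕ) = u * Schub.swapProd t).card : ℤ) := by
    rw [map_sum, Finset.card_filter, Nat.cast_sum]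
    refine Finset.sum_congr rfl fun t _ => ?_
    split_ifs with h
    · rw [← h, h1, Nat.cast_one]
    · rw [h2 _ (Schub.FinPerm.mul_mem u.2 (Schub.swapProd_mem t)) fun h' => h h'.symm,
        Nat.cast_zero]
  -- The number of chains exceeds `c w` by the value of `κ` on `schubert u * f`, which is
  -- nonnegative because this product lies in the cone.
  have hle : c w ≤ ((T.filter fun t => (w : Equiv.Perm ℕ) = u * Schub.swapProd t).card : ℤ) := by
    rw [← hcount, ← hsum, hpow, mul_comm, mul_add, map_add, hcw]
    have := Schub.dual_functional_nonneg h1 h2 (Schub.schubert_mul_grassmannianCone u.2 hu hf)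
    omega
  refine ⟨hnn, ?_⟩
  -- No particular chains are singled out: any `c w` of them will do.
  obtain ⟨S, hS, hcard⟩ := Finset.exists_subset_card_eq (n := (c w).toNat)
    (Int.toNat_le.2 hle)
  refine ⟨S, fun t ht => ?_, by omega⟩
  obtain ⟨ht1, ht2⟩ := Finset.mem_filter.1 (hS ht)
  obtain ⟨h3, h4, h5⟩ := hT t ht1
  exact ⟨h3, h4, ht2, h5⟩
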